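/- Use coordinates $(x,y,z)$ on $\mathbb{R}^3\subset S^3$, with diagrams drawn in the $xy$-plane, $y$ vertical and $z$ pointing towards the viewer. An oriented knot is a smooth embedding of the oriented circle; its mirror image $\overline{K}$ is its image under $(x,y,z)\mapsto(x,y,-z)$, its reverse $r(K)$ is the same circle with the opposite orientation, and two oriented knots are isotopic if they are joined by a smooth one-parameter family of smooth embeddings of the oriented circle. A pure two-component string link $J$ is a smooth proper embedding of two disjoint intervals in $D^2\times[0,1]$ ($D^2$ the unit disk of the $xz$-plane, $[0,1]$ in the $y$-direction), vertical at its ends to infinite order, in which the $i$-th strand runs from the $i$-th base point at the bottom to the $i$-th base point at the top, the two base points being $(x,z)=(\mp\frac12,0)$. Write $\overline{J}$ for its image under $(x,y,z)\mapsto(x,y,-z)$ and $f(x,y,z)=(-x,y,-z)$ for the rotation by $180^\circ$ about the $y$-axis. Let $K=K(J)$ be the knot obtained as follows. Start with a flat disk at the bottom of the diagram and attach two unknotted, untwisted bands (arches, flat in the diagram) to its upper side, with interlaced feet (from left to right: left-hand band, right-hand band, left-hand band, right-hand band), so that the left-hand band passes over the right-hand band at their single crossing. The boundary of this surface is a closed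 curve; replace the two parallel vertical strands at the outer leg of the left-hand band by $J$, and the two parallel vertical strands at the outer leg of the right-hand band by $f(\overline{J})$. Give $K$ an orientation. Then, for every pure two-component string link $J$, the closed curve $K$ is a knot and is negative amphichiral: $K$ is isotopic to $r(\overline{K})$. -/

import Mathlib

open scoped ContDiff

noncomputable section

/-- Euclidean 3-space with coordinates `(x, y, z)`; diagrams are drawn in the `xy`-plane, `y` is
vertical, and `z` points towards the viewer. -/
abbrev R3 : Type := EuclideanSpace ℝ (Fin 3)

/-- An oriented knot: a smooth embedding of the oriented circle `ℝ / ℤ`, written as a smooth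
`1`-periodic immersion `ℝ → ℝ³` that is injective modulo `ℤ`. -/
structure IsKnot (γ : ℝ → R3) : Prop where
  smooth : ContDiff ℝ ∞ γ
  periodic : ∀ s, γ (s + 1) = γ s
  immersion : ∀ s, deriv γ s ≠ 0
  injective : ∀ s t, γ s = γ t → ∃ n : ℤ, s = t + n

/-- Smooth isotopy of oriented knots: a smooth one-parameter family of smooth embeddings of the
oriented circle, from `γ₀` to `γ₁`. -/
def Isotopic (γ₀ γ₁ : ℝ → R3) : Prop :=
  ∃ F : ℝ → ℝ → R3,
    ContDiffOn ℝ ∞ (fun p : ℝ × ℝ => F p.1 p.2) (Set.Icc 0 1 ×ˢ Set.univ) ∧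
    (∀ t ∈ Set.Icc (0 : ℝ) 1, IsKnot (F t)) ∧ F 0 = γ₀ ∧ F 1 = γ₁

/-- The reflection `(x, y, z) ↦ (x, y, -z)` in the plane of the diagram. -/
def mirrorMap (p : R3) : R3 := !₂[p 0, p 1, -p 2]

/-- The flip `f (x, y, z) = (-x, y, -z)`, the rotation by 180 degrees about the `y`-axis. -/
def flipMap (p : R3) : R3 := !₂[-p 0, p 1, -p 2]

/-- The mirror image of a knot. -/
def mirrorImage (γ : ℝ → R3) : ℝ → R3 := fun s => mirrorMap (γ s)

/-- The reverse of a knot: the same circle with the opposite orientation. -/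
def reverseKnot (γ : ℝ → R3) : ℝ → R3 := fun s => γ (-s)

/-- `K` is negative amphichiral: a knot that is isotopic to the reverse of its mirror image. -/
def NegativeAmphichiral (γ : ℝ → R3) : Prop :=
  IsKnot γ ∧ Isotopic γ (reverseKnot (mirrorImage γ))

/-- The `x`-coordinates of the two base points of a string link: `-1/2` and `1/2`. -/
def basePoint : Fin 2 → ℝ := ![-(1 / 2), 1 / 2]

/-- A pure two-component string link: a smooth proper embedding of two disjoint intervals in
`D² × [0, 1]`, where `D²` is the unit disk of the `xz`-plane and the factor `[0, 1]` is the
`y`-direction, such that each strand runs from its base point at the bottom to the same base point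
at the top. The strands meet the ends of the cylinder in the product way, so that they extend
smoothly by vertical rays; `strand i` is the extended strand, and the string link itself is its
restriction to `[0, 1]`. -/
structure StringLink where
  strand : Fin 2 → ℝ → R3
  smooth : ∀ i, ContDiff ℝ ∞ (strand i)
  immersion : ∀ i t, deriv (strand i) t ≠ 0
  injective : ∀ i j s t, strand i s = strand j t → i = j ∧ s = t
  vertical : ∀ i t, t ≤ 0 ∨ 1 ≤ t → strand i t = !₂[basePoint i, t, 0]
  inside : ∀ i, ∀ t ∈ Set.Ioo (0 : ℝ) 1,
    (strand i t 0) ^ 2 + (strand i t 2) ^ 2 < 1 ∧ strand i t 1 ∈ Set.Ioo (0 : ℝ) 1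

/-- A smooth convex function that is `0` for `s ≤ -1/4` and `s` for `1/4 ≤ s`. -/
def ramp (s : ℝ) : ℝ := ∫ u in (-(1 / 4) : ℝ)..s, Real.smoothTransition (2 * u + 1 / 2)

/-- The polygonal path through the points `v 0, …, v 5` with rounded corners. The edge from `v k`
to `v (k + 1)` is run through linearly in the time interval `[k, k + 1]`, except that the velocity
changes smoothly, within time `1/4` of the corner, from one edge vector to the next. -/
def roundedPath (v : Fin 6 → R3) (s : ℝ) : R3 :=
  v 0 + s • (v 1 - v 0)
    + ramp (s - 1) • ((v 2 - v 1) - (v 1 - v 0))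
    + ramp (s - 2) • ((v 3 - v 2) - (v 2 - v 1))
    + ramp (s - 3) • ((v 4 - v 3) - (v 3 - v 2))
    + ramp (s - 4) • ((v 5 - v 4) - (v 4 - v 3))

/-- The strands of `J` in the left-hand cylinder, which is centred over `(-4, 0, 1)`. -/
def leftStrand (J : StringLink) (i : Fin 2) (t : ℝ) : R3 := !₂[-4, 0, 1] + J.strand i t

/-- The strands of `f(J̄)` in the right-hand cylinder, which is centred over `(4, 0, -1)`. As `f`
exchanges the two base points, the strand on the left here is the image of `J.strand 1`, and
the strand on the right is the image of `J.strand 0`. -/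
def rightStrand (J : StringLink) (i : Fin 2) (t : ℝ) : R3 :=
  !₂[4, 0, -1] + flipMap (mirrorMap (J.strand i t))

/-- From the top of the outer strand on the left, along the outer edge of the left-hand band, which
lies in front of the right-hand band, down to the disk and on to the bottom of the inner strand on
the right. -/
def arcA : Fin 6 → R3 :=
  ![!₂[-9 / 2, 1, 1], !₂[-9 / 2, 2, 1], !₂[-3, 4, 1], !₂[2, -1, 1],
    !₂[7 / 2, -1, -1], !₂[7 / 2, 0, -1]]

/-- From the top of the inner strand on the right, along the inner edge of the right-hand band down
to the disk, and up along the inner edge of the left-hand band to the top of the inner strand on the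
left. -/
def arcB : Fin 6 → R3 :=
  ![!₂[7 / 2, 1, -1], !₂[7 / 2, 2, -1], !₂[-1, -1, -1], !₂[1, -1, 1],
    !₂[-7 / 2, 2, 1], !₂[-7 / 2, 1, 1]]

/-- From the bottom of the inner strand on the left to the other foot of the right-hand band, and
along the outer edge of that band, behind the left-hand band, to the top of the outer strand on
the right. -/
def arcC : Fin 6 → R3 :=
  ![!₂[-7 / 2, 0, 1], !₂[-7 / 2, -1, 1], !₂[-2, -1, -1], !₂[3, 4, -1],
    !₂[9 / 2, 2, -1], !₂[9 / 2, 1, -1]]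

/-- From the bottom of the outer strand on the right, along the lower boundary of the disk, to the
bottom of the outer strand on the left. -/
def arcD : Fin 6 → R3 :=
  ![!₂[9 / 2, 0, -1], !₂[9 / 2, -1, -1], !₂[7 / 2, -2, -1], !₂[-7 / 2, -2, 1],
    !₂[-9 / 2, -1, 1], !₂[-9 / 2, 0, 1]]

/-- One turn around the knot `K`, for `u` from `0` to `24`. The knot is the boundary of a disk
(at the bottom of the diagram) with two untwisted, unknotted bands attached to its upper side, with
interlaced feet, the left-hand band passing over the right-hand band, after the two parallel
vertical strands of the left-hand band are replaced by `J` and those of the right-hand band by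
`f(J̄)`. -/
def figureLoop (J : StringLink) (u : ℝ) : R3 :=
  if u < 1 then leftStrand J 0 u
  else if u < 6 then roundedPath arcA (u - 1)
  else if u < 7 then rightStrand J 1 (u - 6)
  else if u < 12 then roundedPath arcB (u - 7)
  else if u < 13 then leftStrand J 1 (13 - u)
  else if u < 18 then roundedPath arcC (u - 13)
  else if u < 19 then rightStrand J 0 (19 - u)
  else roundedPath arcD (u - 19)

/-- The knot `K` built from the string link `J`, as a `1`-periodic map. -/
def figureKnot (J : StringLink) (s : ℝ) : R3 := figureLoop J (24 * Int.fract s)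

end

noncomputable section


/-! ### Isotopies -/

/-! Bring both cylinders to height z = 0. The reflection σ = `flipMap` ∘ `mirrorMap`, which is (x,
y, z) ↦ (-x, y, z), then interchanges the cylinder containing J with the one containing f(J̄). Two
of the four connecting arcs can be laid in the plane z = 0 symmetrically under x ↦ -x: the lower
arc, and a middle arc which between the cylinders runs along the axis y = 1/2, z = 0. The other two
arcs form a double helix of half a turn around this axis. They are interchanged by the flip f rather
than by σ, so σ turns this half twist into the opposite one.

The two half twists differ by a full twist about the axis, and `untwist` removes it by an ambient
isotopy that rotates everything near the axis, on the left, through 2π. At the end of the rotation J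
is back in place, the middle arc has not been moved, and the lower arc enters the rotating region
only along the axis. So the knot in standard position is isotopic to its image under σ, run through
backwards (`untwist_standardKnot`). As σ is the mirror reflection followed by f, and f is the end of
a rotation about the y-axis, that image is isotopic to the reverse of the mirror image.

The figure is brought to standard position by the straight-line homotopy. It only translates the
strands in the z-direction (`linkPiece_lineMap`), so J matters only through a box around each
cylinder. That the arcs stay embedded, mutually disjoint and outside the boxes is reduced to
finitely many integer inequalities (`Certifies.isKnot`), which are evaluated in
`certifies_standard`. -/

theorem IsKnot.comp_left {γ : ℝ → R3} (h : IsKnot γ) {Φ Ψ : R3 → R3} (hΦ : ContDiff ℝ ∞ Φ)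
    (hΨ : Differentiable ℝ Ψ) (inv : ∀ p, Ψ (Φ p) = p) : IsKnot (fun s => Φ (γ s)) where
  smooth := hΦ.comp h.smooth
  periodic s := by simp only [h.periodic]
  immersion s h0 := by
    have hγ : DifferentiableAt ℝ γ s := (h.smooth.differentiable (by simp)) s
    have hd : DifferentiableAt ℝ (fun s => Φ (γ s)) s :=
      ((hΦ.comp h.smooth).differentiable (by simp)) s
    have h1 : HasDerivAt (fun s => Φ (γ s)) 0 s := h0 ▸ hd.hasDerivAt
    have h2 := (hΨ (Φ (γ s))).hasFDerivAt.comp_hasDerivAt s h1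
    have h3 : (Ψ ∘ fun s => Φ (γ s)) = γ := by funext s; simp [inv]
    rw [h3] at h2
    exact h.immersion s (by simpa using h2.deriv)
  injective s t hst := h.injective s t (by simpa [inv] using congrArg Ψ hst)

theorem IsKnot.shift {γ : ℝ → R3} (h : IsKnot γ) (c : ℝ) : IsKnot (fun s => γ (s + c)) where
  smooth := h.smooth.comp (by fun_prop)
  periodic s := by rw [add_right_comm, h.periodic]
  immersion s := by rw [deriv_comp_add_const]; exact h.immersion _
  injective s t hst := by
    obtain ⟨n, hn⟩ := h.injective _ _ hst
    exact ⟨n, by linarith⟩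

theorem IsKnot.reverse {γ : ℝ → R3} (h : IsKnot γ) : IsKnot (reverseKnot γ) where
  smooth := h.smooth.comp (by fun_prop)
  periodic s := by
    unfold reverseKnot
    rw [← h.periodic (-(s + 1))]; congr 1; ring
  immersion s := by
    unfold reverseKnot
    rw [deriv_comp_neg]; exact neg_ne_zero.2 (h.immersion _)
  injective s t hst := by
    obtain ⟨n, hn⟩ := h.injective _ _ hst
    exact ⟨-n, by push_cast; linarith⟩

theorem contDiff_toR3 {E : Type*} [NormedAddCommGroup E] [NormedSpace ℝ E] {a b c : E → ℝ}
    {n : WithTop ℕ∞} (ha : ContDiff ℝ n a) (hb : ContDiff ℝ n b) (hc : ContDiff ℝ n c) :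
    ContDiff ℝ n (fun e => (!₂[a e, b e, c e] : R3)) := by
  rw [contDiff_euclidean]
  intro i
  fin_cases i
  · simpa using ha
  · simpa using hb
  · simpa using hc

theorem contDiff_coord {n : WithTop ℕ∞} (i : Fin 3) : ContDiff ℝ n (fun p : R3 => p i) :=
  (EuclideanSpace.proj (𝕜 := ℝ) i : R3 →L[ℝ] ℝ).contDiff

theorem contDiff_mirrorMap : ContDiff ℝ ∞ mirrorMap :=
  contDiff_toR3 (contDiff_coord 0) (contDiff_coord 1) (contDiff_coord 2).neg

theorem contDiff_flipMap : ContDiff ℝ ∞ flipMap :=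
  contDiff_toR3 (contDiff_coord 0).neg (contDiff_coord 1) (contDiff_coord 2).neg

theorem mirrorMap_mirrorMap (p : R3) : mirrorMap (mirrorMap p) = p := by
  ext i; fin_cases i <;> simp [mirrorMap]

theorem flipMap_flipMap (p : R3) : flipMap (flipMap p) = p := by
  ext i; fin_cases i <;> simp [flipMap]

theorem IsKnot.mirror {γ : ℝ → R3} (h : IsKnot γ) : IsKnot (mirrorImage γ) :=
  h.comp_left contDiff_mirrorMap (contDiff_mirrorMap.differentiable (by simp)) mirrorMap_mirrorMap

theorem Isotopic.symm {γ₀ γ₁ : ℝ → R3} (h : Isotopic γ₀ γ₁) : Isotopic γ₁ γ₀ := by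
  obtain ⟨F, hF, hk, h0, h1⟩ := h
  refine ⟨fun t => F (1 - t), ?_, fun t ht => hk _ ⟨by linarith [ht.2], by linarith [ht.1]⟩,
    by simpa using h1, by simpa using h0⟩
  refine hF.comp (f := fun p : ℝ × ℝ => (1 - p.1, p.2)) (by fun_prop) ?_
  rintro ⟨t, s⟩ ⟨ht, -⟩
  exact ⟨⟨by linarith [ht.2], by linarith [ht.1]⟩, trivial⟩

/-- Since `Real.smoothTransition` takes values in [0, 1], the reparametrised family is smooth for
all real times. It is also stationary near both ends, which allows smooth concatenation. -/
theorem ContDiffOn.comp_smoothTransition {F : ℝ → ℝ → R3}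
    (hF : ContDiffOn ℝ ∞ (fun p : ℝ × ℝ => F p.1 p.2) (Set.Icc 0 1 ×ˢ Set.univ)) (a b : ℝ) :
    ContDiff ℝ ∞ (fun p : ℝ × ℝ => F (Real.smoothTransition (a * p.1 + b)) p.2) := by
  rw [← contDiffOn_univ]
  refine hF.comp (f := fun p : ℝ × ℝ => (Real.smoothTransition (a * p.1 + b), p.2)) ?_ ?_
  · refine ContDiff.contDiffOn (ContDiff.prodMk (Real.smoothTransition.contDiff.comp ?_) contDiff_snd)
    fun_prop
  · rintro ⟨t, s⟩ -
    exact ⟨⟨Real.smoothTransition.nonneg _, Real.smoothTransition.le_one _⟩, trivial⟩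

theorem Isotopic.trans {γ₀ γ₁ γ₂ : ℝ → R3} (h : Isotopic γ₀ γ₁) (h' : Isotopic γ₁ γ₂) :
    Isotopic γ₀ γ₂ := by
  obtain ⟨F, hF, hk, h0, h1⟩ := h
  obtain ⟨G, hG, hk', h0', h1'⟩ := h'
  have hF' := hF.comp_smoothTransition 4 0
  have hG' := hG.comp_smoothTransition 4 (-3)
  have one : ∀ t : ℝ, 1 / 4 ≤ t → Real.smoothTransition (4 * t + 0) = 1 := fun t ht =>
    Real.smoothTransition.one_of_one_le (by linarith)
  have zero : ∀ t : ℝ, t ≤ 3 / 4 → Real.smoothTransition (4 * t + -3) = 0 := fun t ht =>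
    Real.smoothTransition.zero_of_nonpos (by linarith)
  have mem : ∀ x, Real.smoothTransition x ∈ Set.Icc (0 : ℝ) 1 := fun x =>
    ⟨Real.smoothTransition.nonneg _, Real.smoothTransition.le_one _⟩
  -- For t in [1/4, 3/4] both reparametrised families rest at `γ₁`, so switching at 1/2 is smooth.
  refine ⟨fun t => if t ≤ 1 / 2 then F (Real.smoothTransition (4 * t + 0))
    else G (Real.smoothTransition (4 * t + -3)), ?_, ?_, ?_, ?_⟩
  · refine ContDiff.contDiffOn (contDiff_iff_contDiffAt.2 fun p => ?_)
    rcases lt_or_ge p.1 (3 / 4) with hp | hp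
    · refine hF'.contDiffAt.congr_of_eventuallyEq ?_
      filter_upwards [(isOpen_lt continuous_fst continuous_const).mem_nhds hp] with q hq
      have hq : q.1 < 3 / 4 := hq
      by_cases h : q.1 ≤ 1 / 2
      · simp only [h, if_true]
      · simp only [h, if_false]
        rw [zero _ hq.le, one _ (by linarith), h0', h1]
    · refine hG'.contDiffAt.congr_of_eventuallyEq ?_
      have hp : (1 / 4 : ℝ) < p.1 := by linarith
      filter_upwards [(isOpen_lt continuous_const continuous_fst).mem_nhds hp] with q hq
      have hq : 1 / 4 < q.1 := hq
      by_cases h : q.1 ≤ 1 / 2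
      · simp only [h, if_true]
        rw [zero _ (by linarith), one _ hq.le, h0', h1]
      · simp only [h, if_false]
  · intro t _
    dsimp only
    split_ifs
    exacts [hk _ (mem _), hk' _ (mem _)]
  · dsimp only
    rw [if_pos (by norm_num), ← h0]
    congr 1
    exact Real.smoothTransition.zero_of_nonpos (by norm_num)
  · dsimp only
    rw [if_neg (by norm_num), ← h1']
    congr 1
    exact Real.smoothTransition.one_of_one_le (by norm_num)

theorem Isotopic.reverse_mirror {γ₀ γ₁ : ℝ → R3} (h : Isotopic γ₀ γ₁) :
    Isotopic (reverseKnot (mirrorImage γ₀)) (reverseKnot (mirrorImage γ₁)) := by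
  obtain ⟨F, hF, hk, rfl, rfl⟩ := h
  refine ⟨fun t => reverseKnot (mirrorImage (F t)), ?_, fun t ht => (hk t ht).mirror.reverse,
    rfl, rfl⟩
  refine contDiff_mirrorMap.comp_contDiffOn (hF.comp (f := fun p : ℝ × ℝ => (p.1, -p.2))
    (by fun_prop) ?_)
  rintro ⟨t, s⟩ ⟨ht, -⟩
  exact ⟨ht, trivial⟩

/-- A smooth family of maps, each with a smooth left inverse, moves a knot by an isotopy. -/
theorem Isotopic.of_ambient {γ : ℝ → R3} (h : IsKnot γ) (Φ Ψ : ℝ → R3 → R3)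
    (hΦ : ContDiff ℝ ∞ (fun p : ℝ × R3 => Φ p.1 p.2)) (hΨ : ∀ t, Differentiable ℝ (Ψ t))
    (inv : ∀ t p, Ψ t (Φ t p) = p) (h0 : ∀ p, Φ 0 p = p) :
    Isotopic γ (fun s => Φ 1 (γ s)) := by
  refine ⟨fun t s => Φ t (γ s), ?_, fun t _ => ?_, by simp [h0], rfl⟩
  · exact (hΦ.comp (contDiff_fst.prodMk (h.smooth.comp contDiff_snd))).contDiffOn
  · exact h.comp_left (hΦ.comp (contDiff_const.prodMk contDiff_id)) (hΨ t) (inv t)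

theorem Isotopic.of_shift {γ : ℝ → R3} (h : IsKnot γ) (c : ℝ) :
    Isotopic γ (fun s => γ (s + c)) := by
  refine ⟨fun t s => γ (s + t * c), ?_, fun t _ => h.shift _, by simp, by simp⟩
  exact (h.smooth.comp (by fun_prop)).contDiffOn

/-! ### The ramp function -/

theorem smoothTransition_add_one_sub (x : ℝ) :
    Real.smoothTransition x + Real.smoothTransition (1 - x) = 1 := by
  unfold Real.smoothTransition
  have h := Real.smoothTransition.pos_denom x
  rw [show 1 - (1 - x) = x by ring, add_comm (expNegInvGlue (1 - x)) (expNegInvGlue x), ← add_div,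
    div_self h.ne']

theorem hasDerivAt_ramp (s : ℝ) : HasDerivAt ramp (Real.smoothTransition (2 * s + 1 / 2)) s := by
  have hc : Continuous fun u : ℝ => Real.smoothTransition (2 * u + 1 / 2) :=
    Real.smoothTransition.continuous.comp (by fun_prop)
  exact intervalIntegral.integral_hasDerivAt_right (hc.intervalIntegrable _ _)
    (hc.stronglyMeasurableAtFilter _ _) hc.continuousAt

theorem contDiff_ramp : ContDiff ℝ ∞ ramp := by
  rw [contDiff_infty_iff_deriv]
  refine ⟨fun s => (hasDerivAt_ramp s).differentiableAt, ?_⟩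
  rw [funext fun s => (hasDerivAt_ramp s).deriv]
  exact Real.smoothTransition.contDiff.comp (by fun_prop)

theorem ramp_of_le {s : ℝ} (hs : s ≤ -(1 / 4)) : ramp s = 0 := by
  unfold ramp
  rw [intervalIntegral.integral_symm, intervalIntegral.integral_zero_ae, neg_zero]
  refine Filter.Eventually.of_forall fun u hu => ?_
  rw [Set.uIoc_of_le hs] at hu
  exact Real.smoothTransition.zero_of_nonpos (by linarith [hu.2])

/-- The slopes of `ramp` at x and -x add up to 1, so the difference of the two sides is constant,
and it vanishes at 0. -/
theorem ramp_neg (s : ℝ) : ramp (-s) = ramp s - s := by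
  have hd : ∀ x, HasDerivAt (fun s => ramp s - s - ramp (-s)) 0 x := fun x => by
    have h1 := (hasDerivAt_ramp (-x)).comp x (hasDerivAt_neg x)
    have h2 := ((hasDerivAt_ramp x).sub (hasDerivAt_id x)).sub h1
    have := smoothTransition_add_one_sub (2 * x + 1 / 2)
    rw [show 1 - (2 * x + 1 / 2) = 2 * -x + 1 / 2 by ring] at this
    exact h2.congr_deriv (by linarith)
  have := is_const_of_deriv_eq_zero (fun x => (hd x).differentiableAt) (fun x => (hd x).deriv) s 0
  simp only [sub_zero, neg_zero, sub_self] at this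
  linarith

theorem ramp_of_ge {s : ℝ} (hs : 1 / 4 ≤ s) : ramp s = s := by
  have h := ramp_neg s
  rw [ramp_of_le (by linarith)] at h
  linarith

theorem monotone_ramp : Monotone ramp :=
  monotone_of_deriv_nonneg (fun s => (hasDerivAt_ramp s).differentiableAt) fun s => by
    rw [(hasDerivAt_ramp s).deriv]; exact Real.smoothTransition.nonneg _

theorem ramp_nonneg (s : ℝ) : 0 ≤ ramp s := by
  rcases le_total s (-(1 / 4)) with h | h
  · rw [ramp_of_le h]
  · rw [← ramp_of_le (le_refl (-(1 / 4) : ℝ))]; exact monotone_ramp h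

/-- The sum equals 2 `ramp s` - s, which is nondecreasing for s ≥ 0 and equals r at s = r. At a
rounded corner it is the total weight given to the two adjacent edges. -/
theorem ramp_add_ramp_neg_le {s r : ℝ} (hs : |s| ≤ r) (hr : 1 / 4 ≤ r) :
    ramp s + ramp (-s) ≤ r := by
  wlog h0 : 0 ≤ s generalizing s
  · have := this (s := -s) (by rwa [abs_neg]) (by linarith)
    rw [neg_neg] at this
    linarith
  rw [abs_of_nonneg h0] at hs
  have hd : ∀ x, HasDerivAt (fun s => ramp s + ramp s - s)
      (Real.smoothTransition (2 * x + 1 / 2) + Real.smoothTransition (2 * x + 1 / 2) - 1) x :=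
    fun x => ((hasDerivAt_ramp x).add (hasDerivAt_ramp x)).sub (hasDerivAt_id x)
  have hm : MonotoneOn (fun s => ramp s + ramp s - s) (Set.Ici 0) := by
    refine monotoneOn_of_deriv_nonneg (convex_Ici 0)
      (fun x _ => (hd x).continuousAt.continuousWithinAt)
      (fun x _ => (hd x).differentiableAt.differentiableWithinAt) fun x hx => ?_
    rw [interior_Ici, Set.mem_Ioi] at hx
    rw [(hd x).deriv]
    have h1 := smoothTransition_add_one_sub (2 * x + 1 / 2)
    have h2 : Real.smoothTransition (1 - (2 * x + 1 / 2)) ≤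
        Real.smoothTransition (2 * x + 1 / 2) :=
      Real.smoothTransition.monotone (by linarith)
    linarith
  have h3 := hm h0 (show (0 : ℝ) ≤ r by linarith) hs
  simp only [ramp_of_ge hr] at h3
  rw [ramp_neg]
  linarith


/-! ### Knots glued from the strands of a string link and four arcs -/

/-- The four strands in the order in which the knot runs through them, with the left-hand cylinder
at height `h` and the right-hand cylinder at height `-h`. -/
def linkPiece (J : StringLink) (h : ℝ) (i : Fin 4) (τ : ℝ) : R3 :=
  match i with
  | 0 => !₂[-4, 0, h] + J.strand 0 τ
  | 1 => !₂[4, 0, -h] + flipMap (mirrorMap (J.strand 1 τ))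
  | 2 => !₂[-4, 0, h] + J.strand 1 (1 - τ)
  | 3 => !₂[4, 0, -h] + flipMap (mirrorMap (J.strand 0 (1 - τ)))

/-- One turn around the closed curve made of the four strands and the arcs `a 0, …, a 3`. -/
def assembleLoop (J : StringLink) (h : ℝ) (a : Fin 4 → ℝ → R3) (u : ℝ) : R3 :=
  if u < 1 then linkPiece J h 0 u
  else if u < 6 then a 0 (u - 1)
  else if u < 7 then linkPiece J h 1 (u - 6)
  else if u < 12 then a 1 (u - 7)
  else if u < 13 then linkPiece J h 2 (u - 12)
  else if u < 18 then a 2 (u - 13)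
  else if u < 19 then linkPiece J h 3 (u - 18)
  else a 3 (u - 19)

/-- The closed curve made of the four strands and the arcs `a 0, …, a 3`. -/
def assemble (J : StringLink) (h : ℝ) (a : Fin 4 → ℝ → R3) (s : ℝ) : R3 :=
  assembleLoop J h a (24 * Int.fract s)

/-- The arcs continue the vertical ends of the strands. -/
structure Fits (J : StringLink) (h : ℝ) (a : Fin 4 → ℝ → R3) : Prop where
  start : ∀ i s, 0 ≤ s → s ≤ 1 / 4 → a i s = linkPiece J h i (1 + s)
  finish : ∀ i s, 19 / 4 ≤ s → s ≤ 5 → a i s = linkPiece J h (i + 1) (s - 5)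

/-- The closed curve `γ` runs through the four strands and the arcs `a 0, …, a 3`. -/
structure Decomposes (J : StringLink) (γ : ℝ → R3) (h : ℝ) (a : Fin 4 → ℝ → R3) : Prop where
  periodic : ∀ s, γ (s + 1) = γ s
  on_piece : ∀ i : Fin 4, ∀ τ ∈ Set.Icc (-(1 / 4) : ℝ) (5 / 4),
    γ ((6 * (i : ℕ) + τ) / 24) = linkPiece J h i τ
  on_arc : ∀ i : Fin 4, ∀ s ∈ Set.Icc (0 : ℝ) 5, γ ((6 * (i : ℕ) + 1 + s) / 24) = a i s
  smooth_arc : ∀ i, ContDiff ℝ ∞ (a i)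

theorem assemble_div {J : StringLink} {h : ℝ} {a : Fin 4 → ℝ → R3} {u : ℝ} (h0 : 0 ≤ u)
    (h1 : u < 24) : assemble J h a (u / 24) = assembleLoop J h a u := by
  unfold assemble
  rw [Int.fract_eq_self.2 ⟨by positivity, by linarith⟩]
  congr 1
  ring

theorem Fits.decomposes {J : StringLink} {h : ℝ} {a : Fin 4 → ℝ → R3} (hf : Fits J h a)
    (ha : ∀ i, ContDiff ℝ ∞ (a i)) : Decomposes J (assemble J h a) h a := by
  have per : ∀ s, assemble J h a (s + 1) = assemble J h a s := fun s => by
    unfold assemble; rw [Int.fract_add_one]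
  have wrap : ∀ u, assemble J h a (u / 24) = assemble J h a ((u + 24) / 24) := fun u => by
    rw [← per]; congr 1; ring
  have f0 := hf.finish 0
  have f1 := hf.finish 1
  have f2 := hf.finish 2
  have f3 := hf.finish 3
  have e3 : (3 : Fin 4) + 1 = 0 := rfl
  simp only [e3, zero_add, Fin.reduceAdd] at f0 f1 f2 f3
  refine ⟨per, ?_, ?_, ha⟩
  · rintro i τ ⟨h0, h1⟩
    fin_cases i
    · rcases lt_or_ge τ 0 with hτ | hτ
      · simp only [Fin.zero_eta, Nat.cast_zero, mul_zero, zero_add]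
        -- Negative times on strand 0 belong to the end of the last arc, one period later.
        rw [wrap, assemble_div (by linarith) (by linarith)]
        unfold assembleLoop
        split_ifs <;> try (exfalso; linarith)
        rw [f3 _ (by linarith) (by linarith)]; congr 1; ring
      · simp only [Fin.zero_eta, Nat.cast_zero, mul_zero, zero_add]
        rw [assemble_div (by linarith) (by linarith)]
        unfold assembleLoop
        split_ifs <;> try (exfalso; linarith)
        · rfl
        · rw [hf.start _ _ (by linarith) (by linarith)]; congr 1; ring
    · simp only [Fin.mk_one, Nat.cast_one, mul_one]
      rw [assemble_div (by linarith) (by linarith)]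
      unfold assembleLoop
      split_ifs <;> try (exfalso; linarith)
      · rw [f0 _ (by linarith) (by linarith)]; congr 1; ring
      · congr 1; ring
      · rw [hf.start _ _ (by linarith) (by linarith)]; congr 1; ring
    · simp only [Fin.reduceFinMk, Nat.cast_ofNat]
      rw [assemble_div (by linarith) (by linarith)]
      unfold assembleLoop
      split_ifs <;> try (exfalso; linarith)
      · rw [f1 _ (by linarith) (by linarith)]; congr 1; ring
      · congr 1; ring
      · rw [hf.start _ _ (by linarith) (by linarith)]; congr 1; ring
    · simp only [Fin.reduceFinMk, Nat.cast_ofNat]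
      rw [assemble_div (by norm_num; linarith) (by norm_num; linarith)]
      norm_num
      unfold assembleLoop
      split_ifs <;> try (exfalso; linarith)
      · rw [f2 _ (by linarith) (by linarith)]; congr 1; ring
      · congr 1; ring
      · rw [hf.start _ _ (by linarith) (by linarith)]; congr 1; ring
  · rintro i s ⟨h0, h1⟩
    fin_cases i
    · simp only [Fin.zero_eta, Nat.cast_zero, mul_zero, zero_add]
      rw [assemble_div (by linarith) (by linarith)]
      unfold assembleLoop
      split_ifs <;> try (exfalso; linarith)
      · congr 1; ring
      · rw [f0 _ (by linarith) (by linarith)]; congr 1; ring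
    · simp only [Fin.mk_one, Nat.cast_one, mul_one]
      rw [assemble_div (by linarith) (by linarith)]
      unfold assembleLoop
      split_ifs <;> try (exfalso; linarith)
      · congr 1; ring
      · rw [f1 _ (by linarith) (by linarith)]; congr 1; ring
    · simp only [Fin.reduceFinMk, Nat.cast_ofNat]
      rw [assemble_div (by linarith) (by linarith)]
      unfold assembleLoop
      split_ifs <;> try (exfalso; linarith)
      · congr 1; ring
      · rw [f2 _ (by linarith) (by linarith)]; congr 1; ring
    · simp only [Fin.reduceFinMk]
      norm_num
      rcases h1.lt_or_eq with h1 | h1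
      · rw [assemble_div (by linarith) (by linarith)]
        unfold assembleLoop
        split_ifs <;> try (exfalso; linarith)
        congr 1; ring
      -- The end of the last arc is at time 24, where the fractional part has already jumped back to
      -- 0.
      · rw [f3 _ (by linarith) (by linarith), h1, show ((19 + 5 : ℝ) / 24) = (0 / 24 : ℝ) + 1 by norm_num, per,
          assemble_div le_rfl (by norm_num)]
        unfold assembleLoop
        norm_num

theorem figureKnot_eq_assemble (J : StringLink) : figureKnot J = assemble J 1
    ![roundedPath arcA, roundedPath arcB, roundedPath arcC, roundedPath arcD] := by
  funext s
  simp only [figureKnot, assemble, figureLoop, assembleLoop, linkPiece, leftStrand, rightStrand]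
  have e1 : ∀ u : ℝ, 1 - (u - 12) = 13 - u := fun u => by ring
  have e2 : ∀ u : ℝ, 1 - (u - 18) = 19 - u := fun u => by ring
  simp only [e1, e2]
  rfl

theorem contDiff_linkPiece (J : StringLink) (h : ℝ) (i : Fin 4) :
    ContDiff ℝ ∞ (linkPiece J h i) := by
  have h1 : ContDiff ℝ ∞ fun τ : ℝ => 1 - τ := by fun_prop
  fin_cases i
  · exact contDiff_const.add (J.smooth 0)
  · exact contDiff_const.add (contDiff_flipMap.comp (contDiff_mirrorMap.comp (J.smooth 1)))
  · exact contDiff_const.add ((J.smooth 1).comp h1)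
  · exact contDiff_const.add
      (contDiff_flipMap.comp (contDiff_mirrorMap.comp ((J.smooth 0).comp h1)))

theorem exists_block {u : ℝ} (h0 : 0 ≤ u) (h1 : u < 24) :
    ∃ i : Fin 4, 6 * ((i : ℕ) : ℝ) ≤ u ∧ u < 6 * ((i : ℕ) : ℝ) + 6 := by
  rcases lt_or_ge u 6 with h | h
  · exact ⟨0, by simpa using h0, by simpa using h⟩
  rcases lt_or_ge u 12 with h' | h'
  · exact ⟨1, by simpa using h, by norm_num; exact h'⟩
  rcases lt_or_ge u 18 with h'' | h''
  · exact ⟨2, by norm_num; exact h', by norm_num; exact h''⟩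
  · exact ⟨3, by norm_num; exact h'', by norm_num; exact h1⟩

theorem Decomposes.eq_sub_int {J : StringLink} {γ : ℝ → R3} {h : ℝ} {a : Fin 4 → ℝ → R3}
    (hd : Decomposes J γ h a) (s : ℝ) (n : ℤ) : γ s = γ (s - n) := by
  have hp : Function.Periodic γ 1 := hd.periodic
  have := hp.sub_zsmul_eq n (x := s)
  rw [zsmul_one] at this
  exact this.symm

/-- Every point of the curve lies on a closed strand or on an open arc. -/
theorem Decomposes.exists_local {J : StringLink} {γ : ℝ → R3} {h : ℝ} {a : Fin 4 → ℝ → R3}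
    (hd : Decomposes J γ h a) (s : ℝ) : ∃ (n : ℤ) (i : Fin 4),
      (24 * (s - n) - 6 * (i : ℕ) ∈ Set.Icc (0 : ℝ) 1 ∧
        γ =ᶠ[nhds s] fun s' => linkPiece J h i (24 * (s' - n) - 6 * (i : ℕ))) ∨
      (24 * (s - n) - 6 * (i : ℕ) - 1 ∈ Set.Ioo (0 : ℝ) 5 ∧
        γ =ᶠ[nhds s] fun s' => a i (24 * (s' - n) - 6 * (i : ℕ) - 1)) := by
  obtain ⟨i, hi0, hi1⟩ := exists_block (u := 24 * (s - ⌊s⌋))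
    (by have := Int.floor_le s; linarith) (by have := Int.lt_floor_add_one s; linarith)
  refine ⟨⌊s⌋, i, ?_⟩
  set n := ⌊s⌋
  have hc : Continuous fun s' : ℝ => 24 * (s' - n) - 6 * ((i : ℕ) : ℝ) := by fun_prop
  rcases le_or_gt (24 * (s - n) - 6 * ((i : ℕ) : ℝ)) 1 with h1 | h1
  · refine Or.inl ⟨⟨by linarith, h1⟩, ?_⟩
    filter_upwards [hc.continuousAt.eventually (Ioo_mem_nhds (a := -(1 / 4)) (b := 5 / 4)
      (by linarith) (by linarith))] with s' hs'
    rw [hd.eq_sub_int s' n, ← hd.on_piece i _ ⟨hs'.1.le, hs'.2.le⟩]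
    congr 1
    ring
  · refine Or.inr ⟨⟨by linarith, by linarith⟩, ?_⟩
    filter_upwards [hc.continuousAt.eventually (Ioo_mem_nhds (a := 1) (b := 6)
      h1 (by linarith))] with s' hs'
    rw [hd.eq_sub_int s' n, ← hd.on_arc i _ ⟨by linarith [hs'.1], by linarith [hs'.2]⟩]
    congr 1
    ring

theorem Decomposes.contDiff {J : StringLink} {γ : ℝ → R3} {h : ℝ} {a : Fin 4 → ℝ → R3}
    (hd : Decomposes J γ h a) : ContDiff ℝ ∞ γ := by
  refine contDiff_iff_contDiffAt.2 fun s => ?_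
  obtain ⟨n, i, ⟨-, he⟩ | ⟨-, he⟩⟩ := hd.exists_local s
  · exact ((contDiff_linkPiece J h i).comp (by fun_prop)).contDiffAt.congr_of_eventuallyEq he
  · exact ((hd.smooth_arc i).comp (by fun_prop)).contDiffAt.congr_of_eventuallyEq he

/-! ### Embeddedness of a curve through the two cylinders. -/

/-- A box around the left-hand cylinder. -/
def InLeftBox (h : ℝ) (p : R3) : Prop :=
  (-5 ≤ p 0 ∧ p 0 ≤ -3) ∧ (0 ≤ p 1 ∧ p 1 ≤ 1) ∧ (h - 1 ≤ p 2 ∧ p 2 ≤ h + 1)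

/-- A box around the right-hand cylinder. -/
def InRightBox (h : ℝ) (p : R3) : Prop :=
  (3 ≤ p 0 ∧ p 0 ≤ 5) ∧ (0 ≤ p 1 ∧ p 1 ≤ 1) ∧ (-h - 1 ≤ p 2 ∧ p 2 ≤ -h + 1)

theorem StringLink.strand_bounds (J : StringLink) (i : Fin 2) {t : ℝ} (ht : t ∈ Set.Icc (0 : ℝ) 1) :
    (-1 ≤ J.strand i t 0 ∧ J.strand i t 0 ≤ 1) ∧ (0 ≤ J.strand i t 1 ∧ J.strand i t 1 ≤ 1) ∧
      (-1 ≤ J.strand i t 2 ∧ J.strand i t 2 ≤ 1) := by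
  by_cases h : t ≤ 0 ∨ 1 ≤ t
  · rw [J.vertical i t h]
    fin_cases i <;> simp [basePoint, ht.1, ht.2] <;> norm_num
  · push Not at h
    obtain ⟨h1, h2⟩ := J.inside i t ⟨h.1, h.2⟩
    have hx : J.strand i t 0 ^ 2 ≤ 1 := by nlinarith [sq_nonneg (J.strand i t 2)]
    have hz : J.strand i t 2 ^ 2 ≤ 1 := by nlinarith [sq_nonneg (J.strand i t 0)]
    exact ⟨abs_le.1 ((sq_le_one_iff_abs_le_one _).1 hx), ⟨h2.1.le, h2.2.le⟩,
      abs_le.1 ((sq_le_one_iff_abs_le_one _).1 hz)⟩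

theorem linkPiece_mem_box (J : StringLink) (h : ℝ) (i : Fin 4) {τ : ℝ} (hτ : τ ∈ Set.Icc (0 : ℝ) 1) :
    InLeftBox h (linkPiece J h i τ) ∨ InRightBox h (linkPiece J h i τ) := by
  have hτ' : 1 - τ ∈ Set.Icc (0 : ℝ) 1 := ⟨by linarith [hτ.2], by linarith [hτ.1]⟩
  have b0 := fun j => J.strand_bounds j hτ
  have b1 := fun j => J.strand_bounds j hτ'
  fin_cases i
  · left
    obtain ⟨⟨_, _⟩, ⟨_, _⟩, _, _⟩ := b0 0
    refine ⟨⟨?_, ?_⟩, ⟨?_, ?_⟩, ?_, ?_⟩ <;> simp [linkPiece] <;> linarith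
  · right
    obtain ⟨⟨_, _⟩, ⟨_, _⟩, _, _⟩ := b0 1
    refine ⟨⟨?_, ?_⟩, ⟨?_, ?_⟩, ?_, ?_⟩ <;> simp [linkPiece, flipMap, mirrorMap] <;> linarith
  · left
    obtain ⟨⟨_, _⟩, ⟨_, _⟩, _, _⟩ := b1 1
    refine ⟨⟨?_, ?_⟩, ⟨?_, ?_⟩, ?_, ?_⟩ <;> simp [linkPiece] <;> linarith
  · right
    obtain ⟨⟨_, _⟩, ⟨_, _⟩, _, _⟩ := b1 0
    refine ⟨⟨?_, ?_⟩, ⟨?_, ?_⟩, ?_, ?_⟩ <;> simp [linkPiece, flipMap, mirrorMap] <;> linarith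

theorem flipMap_mirrorMap_injective {p q : R3}
    (h : flipMap (mirrorMap p) = flipMap (mirrorMap q)) : p = q := by
  rw [← mirrorMap_mirrorMap p, ← flipMap_flipMap (mirrorMap p), h, flipMap_flipMap,
    mirrorMap_mirrorMap]

/-- Pieces in different cylinders are told apart by the sign of x. Within one cylinder the claim is
the injectivity of J, after cancelling the translation and, on the right, the bijection `flipMap` ∘
`mirrorMap`. -/
theorem linkPiece_injective (J : StringLink) (h : ℝ) {i j : Fin 4} {τ τ' : ℝ}
    (hτ : τ ∈ Set.Icc (0 : ℝ) 1) (hτ' : τ' ∈ Set.Icc (0 : ℝ) 1)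
    (he : linkPiece J h i τ = linkPiece J h j τ') : i = j ∧ τ = τ' := by
  have x0 := fun k => (J.strand_bounds k hτ).1
  have x1 := fun k => (J.strand_bounds k hτ').1
  have y0 := fun k => (J.strand_bounds k (t := 1 - τ) ⟨by linarith [hτ.2], by linarith [hτ.1]⟩).1
  have y1 := fun k => (J.strand_bounds k (t := 1 - τ') ⟨by linarith [hτ'.2], by linarith [hτ'.1]⟩).1
  have hx := congrArg (fun p : R3 => p 0) he
  have := x0 0; have := x0 1; have := x1 0; have := x1 1
  have := y0 0; have := y0 1; have := y1 0; have := y1 1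
  fin_cases i <;> fin_cases j <;>
    first
    | (exfalso; simp [linkPiece, flipMap, mirrorMap] at hx; linarith)
    | (have e := J.injective _ _ _ _ (add_left_cancel he)
       first
       | exact absurd e.1 (by decide)
       | exact ⟨rfl, by linarith [e.2]⟩)
    | (have e := J.injective _ _ _ _ (flipMap_mirrorMap_injective (add_left_cancel he))
       first
       | exact absurd e.1 (by decide)
       | exact ⟨rfl, by linarith [e.2]⟩)

/-- Each piece is a strand, reparametrised by an affine map of slope ±1 and followed by a
translation and a map with differentiable left inverse. -/
theorem deriv_linkPiece_ne_zero (J : StringLink) (h : ℝ) (i : Fin 4) (τ : ℝ) :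
    deriv (linkPiece J h i) τ ≠ 0 := by
  have key : ∀ (c : R3) (j : Fin 2) (Φ : R3 → R3) (Ψ : R3 → R3), Differentiable ℝ Φ →
      Differentiable ℝ Ψ → (∀ p, Ψ (Φ p) = p) → ∀ (ε δ : ℝ), ε ≠ 0 →
      deriv (fun τ => c + Φ (J.strand j (ε * τ + δ))) τ ≠ 0 := by
    intro c j Φ Ψ hΦ hΨ inv ε δ hε h0
    rw [deriv_const_add] at h0
    have hJ : DifferentiableAt ℝ (fun τ => J.strand j (ε * τ + δ)) τ :=
      ((J.smooth j).differentiable (by simp) _).comp τ (by fun_prop)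
    have h1 : HasDerivAt (fun τ => Φ (J.strand j (ε * τ + δ))) 0 τ :=
      h0 ▸ ((hΦ _).comp τ hJ).hasDerivAt
    have h2 := (hΨ (Φ (J.strand j (ε * τ + δ)))).hasFDerivAt.comp_hasDerivAt τ h1
    have h3 : (Ψ ∘ fun τ => Φ (J.strand j (ε * τ + δ))) = fun τ => J.strand j (ε * τ + δ) := by
      funext s; simp [inv]
    rw [h3, map_zero] at h2
    have h4 : HasDerivAt (fun τ : ℝ => ε * τ + δ) ε τ := by
      simpa using ((hasDerivAt_id τ).const_mul ε).add_const δ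
    have h5 := ((J.smooth j).differentiable (by simp) (ε * τ + δ)).hasDerivAt.scomp τ h4
    have h6 := h5.unique h2
    exact J.immersion j _ ((smul_eq_zero.1 h6).resolve_left hε)
  have dm : Differentiable ℝ fun p => flipMap (mirrorMap p) :=
    (contDiff_flipMap.comp contDiff_mirrorMap).differentiable (by simp)
  have dm' : Differentiable ℝ fun p => mirrorMap (flipMap p) :=
    (contDiff_mirrorMap.comp contDiff_flipMap).differentiable (by simp)
  have inv : ∀ p, mirrorMap (flipMap (flipMap (mirrorMap p))) = p := fun p => by
    rw [flipMap_flipMap, mirrorMap_mirrorMap]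
  fin_cases i
  · have e : linkPiece J h 0 = fun τ => !₂[-4, 0, h] + id (J.strand 0 (1 * τ + 0)) := by
      funext τ; simp [linkPiece]
    exact e ▸ key _ 0 _ _ differentiable_id differentiable_id (fun _ => rfl) 1 0 one_ne_zero
  · have e : linkPiece J h 1 =
        fun τ => !₂[4, 0, -h] + flipMap (mirrorMap (J.strand 1 (1 * τ + 0))) := by
      funext τ; simp [linkPiece]
    exact e ▸ key _ 1 _ _ dm dm' inv 1 0 one_ne_zero
  · have e : linkPiece J h 2 = fun τ => !₂[-4, 0, h] + id (J.strand 1 (-1 * τ + 1)) := by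
      funext τ; simp [linkPiece, neg_add_eq_sub]
    exact e ▸ key _ 1 _ _ differentiable_id differentiable_id (fun _ => rfl) (-1) 1 (by norm_num)
  · have e : linkPiece J h 3 =
        fun τ => !₂[4, 0, -h] + flipMap (mirrorMap (J.strand 0 (-1 * τ + 1))) := by
      funext τ; simp [linkPiece, neg_add_eq_sub]
    exact e ▸ key _ 0 _ _ dm dm' inv (-1) 1 (by norm_num)

theorem deriv_comp_block {f : ℝ → R3} (hf : Differentiable ℝ f) (c n : ℝ) (d s : ℝ) :
    deriv (fun s' => f (24 * (s' - n) - c - d)) s = (24 : ℝ) • deriv f (24 * (s - n) - c - d) := by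
  have h4 : HasDerivAt (fun s' : ℝ => 24 * (s' - n) - c - d) 24 s := by
    simpa using ((((hasDerivAt_id s).sub_const n).const_mul 24).sub_const c).sub_const d
  exact ((hf _).hasDerivAt.scomp s h4).deriv

/-- A curve through the strands is a knot if its arcs are embedded and disjoint, and avoid the
boxes around the cylinders. -/
theorem Decomposes.isKnot {J : StringLink} {γ : ℝ → R3} {h : ℝ} {a : Fin 4 → ℝ → R3}
    (hd : Decomposes J γ h a) (himm : ∀ i, ∀ s ∈ Set.Ioo (0 : ℝ) 5, deriv (a i) s ≠ 0)
    (hinj : ∀ i j, ∀ s ∈ Set.Ioo (0 : ℝ) 5, ∀ s' ∈ Set.Ioo (0 : ℝ) 5,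
      a i s = a j s' → i = j ∧ s = s')
    (hbox : ∀ i, ∀ s ∈ Set.Ioo (0 : ℝ) 5, ¬ InLeftBox h (a i s) ∧ ¬ InRightBox h (a i s)) :
    IsKnot γ where
  smooth := hd.contDiff
  periodic := hd.periodic
  immersion s := by
    obtain ⟨n, i, ⟨hm, he⟩ | ⟨hm, he⟩⟩ := hd.exists_local s
    · rw [he.deriv_eq]
      have := deriv_comp_block ((contDiff_linkPiece J h i).differentiable (by simp)) (6 * (i : ℕ)) n 0 s
      simp only [sub_zero] at this
      rw [this]
      exact smul_ne_zero (by norm_num) (deriv_linkPiece_ne_zero J h i _)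
    · rw [he.deriv_eq, deriv_comp_block ((hd.smooth_arc i).differentiable (by simp))]
      exact smul_ne_zero (by norm_num) (himm i _ hm)
  injective s t hst := by
    obtain ⟨n, i, ⟨hm, he⟩ | ⟨hm, he⟩⟩ := hd.exists_local s <;>
    obtain ⟨n', i', ⟨hm', he'⟩ | ⟨hm', he'⟩⟩ := hd.exists_local t <;>
    rw [he.eq_of_nhds, he'.eq_of_nhds] at hst
    · obtain ⟨rfl, h1⟩ := linkPiece_injective J h hm hm' hst
      exact ⟨n - n', by push_cast; linarith⟩
    · exfalso
      have h1 := hbox i' _ hm'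
      rw [← hst] at h1
      rcases linkPiece_mem_box J h i hm with h2 | h2
      exacts [h1.1 h2, h1.2 h2]
    · exfalso
      have h1 := hbox i _ hm
      rw [hst] at h1
      rcases linkPiece_mem_box J h i' hm' with h2 | h2
      exacts [h1.1 h2, h1.2 h2]
    · obtain ⟨rfl, h1⟩ := hinj i i' _ hm _ hm' hst
      exact ⟨n - n', by push_cast; linarith⟩

/-- The pieces are affine in the height, so the straight-line homotopy moves each cylinder rigidly.
This is what makes the homotopy work for arbitrary J. -/
theorem linkPiece_lineMap (J : StringLink) (h₀ h₁ t : ℝ) (i : Fin 4) (τ : ℝ) :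
    (1 - t) • linkPiece J h₀ i τ + t • linkPiece J h₁ i τ = linkPiece J ((1 - t) * h₀ + t * h₁) i τ := by
  ext k
  fin_cases i <;> fin_cases k <;> simp [linkPiece, flipMap, mirrorMap] <;> ring

theorem Decomposes.lineMap {J : StringLink} {γ₀ γ₁ : ℝ → R3} {h₀ h₁ : ℝ}
    {a₀ a₁ : Fin 4 → ℝ → R3} (hd₀ : Decomposes J γ₀ h₀ a₀) (hd₁ : Decomposes J γ₁ h₁ a₁) (t : ℝ) :
    Decomposes J (fun s => (1 - t) • γ₀ s + t • γ₁ s) ((1 - t) * h₀ + t * h₁)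
      (fun i s => (1 - t) • a₀ i s + t • a₁ i s) where
  periodic s := by simp only [hd₀.periodic, hd₁.periodic]
  on_piece i τ hτ := by
    simp only [hd₀.on_piece i τ hτ, hd₁.on_piece i τ hτ, linkPiece_lineMap]
  on_arc i s hs := by simp only [hd₀.on_arc i s hs, hd₁.on_arc i s hs]
  smooth_arc i := ((hd₀.smooth_arc i).const_smul (1 - t)).add ((hd₁.smooth_arc i).const_smul t)


/-! ### Certified straight-line isotopies -/

/-- Integer vectors, used both as points (in units of `1/24`) and as linear functionals. -/
abbrev IntVec : Type := ℤ × ℤ × ℤ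

/-- The dot product of integer vectors. -/
def intDot (c p : IntVec) : ℤ := c.1 * p.1 + c.2.1 * p.2.1 + c.2.2 * p.2.2

/-- The linear functional on `ℝ³` with integer coefficients `c`. -/
def pairing (c : IntVec) : R3 →L[ℝ] ℝ :=
  (c.1 : ℝ) • (EuclideanSpace.proj 0 : R3 →L[ℝ] ℝ) + (c.2.1 : ℝ) • EuclideanSpace.proj 1
    + (c.2.2 : ℝ) • EuclideanSpace.proj 2

theorem pairing_apply (c : IntVec) (p : R3) :
    pairing c p = c.1 * p 0 + c.2.1 * p 1 + c.2.2 * p 2 := by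
  simp [pairing]

theorem pairing_neg (c : IntVec) (p : R3) : pairing (-c) p = -pairing c p := by
  simp only [pairing_apply, Prod.fst_neg, Prod.snd_neg, Int.cast_neg]; ring

theorem intDot_neg (c p : IntVec) : intDot (-c) p = -intDot c p := by
  simp only [intDot, Prod.fst_neg, Prod.snd_neg]; ring

/-- `p` lies in the convex hull of the points of `H` (in units of `1/24`), as far as integer
functionals can tell. -/
def InHull (H : List IntVec) (p : R3) : Prop :=
  ∀ (c : IntVec) (m : ℤ), (∀ q ∈ H, m ≤ intDot c q) → (m : ℝ) ≤ 24 * pairing c p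

/-- `v` lies in the interior of the cone dual to the functionals that are positive on `V`. -/
def InCone (V : List IntVec) (v : R3) : Prop :=
  ∀ c : IntVec, (∀ q ∈ V, 0 < intDot c q) → 0 < pairing c v

/-- Integer values that are strictly ordered differ by at least 1, so the weak bounds of `InHull`
give a strict inequality. An empty `H'` is impossible, as it would bound a real number below by
every integer. -/
theorem InHull.pairing_lt {H H' : List IntVec} {x y : R3} (hx : InHull H x) (hy : InHull H' y)
    {c : IntVec} (h : ∀ p ∈ H, ∀ q ∈ H', intDot c p < intDot c q) : pairing c x < pairing c y := by
  rcases H'.eq_nil_or_concat with rfl | ⟨L, b, hL⟩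
  · have h1 := hy c (⌊24 * pairing c y⌋ + 1) (by simp)
    have h2 := Int.lt_floor_add_one (24 * pairing c y)
    push_cast at h1
    linarith
  have hne : H'.toFinset.Nonempty := ⟨b, by simp [hL]⟩
  obtain ⟨q, hq, hmin⟩ := H'.toFinset.exists_min_image (intDot c) hne
  have h1 := hy c (intDot c q) fun q' hq' => hmin q' (by simpa using hq')
  have h2 := hx (-c) (-intDot c q + 1) fun p hp => by
    have := h p hp q (by simpa using hq)
    rw [intDot_neg]; linarith
  rw [pairing_neg] at h2
  push_cast at h2
  linarith

/-- Bounds for the position and the velocity of a piece of a curve. -/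
structure Piece where
  hull : List IntVec
  vel : List IntVec

/-- The curve `a` on `[0, 5]` stays within the bounds `P k` for times in
`[k / 2 - 1 / 4, k / 2 + 1 / 4]`. -/
structure Tracks (a : ℝ → R3) (P : Fin 11 → Piece) : Prop where
  pos : ∀ k : Fin 11, ∀ s ∈ Set.Icc (0 : ℝ) 5, |2 * s - (k : ℕ)| ≤ 1 / 2 → InHull (P k).hull (a s)
  vel : ∀ k : Fin 11, ∀ s ∈ Set.Icc (0 : ℝ) 5, |2 * s - (k : ℕ)| ≤ 1 / 2 →
    InCone (P k).vel (deriv a s)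

/-- The vertices of an axis-parallel box. -/
def boxHull (lo hi : IntVec) : List IntVec :=
  [(lo.1, lo.2.1, lo.2.2), (lo.1, lo.2.1, hi.2.2), (lo.1, hi.2.1, lo.2.2), (lo.1, hi.2.1, hi.2.2),
    (hi.1, lo.2.1, lo.2.2), (hi.1, lo.2.1, hi.2.2), (hi.1, hi.2.1, lo.2.2), (hi.1, hi.2.1, hi.2.2)]

/-- A linear functional on a box is minimal at the vertex selected by the signs of its coefficients;
the eight cases are the sign patterns. -/
theorem inHull_boxHull {lo hi : IntVec} {p : R3} (h0 : (lo.1 : ℝ) ≤ 24 * p 0)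
    (h0' : 24 * p 0 ≤ hi.1) (h1 : (lo.2.1 : ℝ) ≤ 24 * p 1) (h1' : 24 * p 1 ≤ hi.2.1)
    (h2 : (lo.2.2 : ℝ) ≤ 24 * p 2) (h2' : 24 * p 2 ≤ hi.2.2) : InHull (boxHull lo hi) p := by
  intro c m hm
  have key : ∀ (e : ℤ) (l u : ℤ) (x : ℝ), (l : ℝ) ≤ x → x ≤ u →
      ((e * l : ℤ) : ℝ) ≤ e * x ∨ ((e * u : ℤ) : ℝ) ≤ e * x := by
    intro e l u x hl hu
    push_cast
    rcases le_total 0 e with h | h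
    · exact Or.inl (mul_le_mul_of_nonneg_left hl (by exact_mod_cast h))
    · exact Or.inr (mul_le_mul_of_nonpos_left hu (by exact_mod_cast h))
  simp only [boxHull, List.mem_cons, List.not_mem_nil, or_false, forall_eq_or_imp, forall_eq,
    intDot] at hm
  obtain ⟨m1, m2, m3, m4, m5, m6, m7, m8⟩ := hm
  rw [pairing_apply]
  rcases key c.1 _ _ _ h0 h0' with k0 | k0 <;> rcases key c.2.1 _ _ _ h1 h1' with k1 | k1 <;>
    rcases key c.2.2 _ _ _ h2 h2' with k2 | k2
  · have m' : (m : ℝ) ≤ _ := Int.cast_le.2 m1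
    push_cast at m' k0 k1 k2; linarith
  · have m' : (m : ℝ) ≤ _ := Int.cast_le.2 m2
    push_cast at m' k0 k1 k2; linarith
  · have m' : (m : ℝ) ≤ _ := Int.cast_le.2 m3
    push_cast at m' k0 k1 k2; linarith
  · have m' : (m : ℝ) ≤ _ := Int.cast_le.2 m4
    push_cast at m' k0 k1 k2; linarith
  · have m' : (m : ℝ) ≤ _ := Int.cast_le.2 m5
    push_cast at m' k0 k1 k2; linarith
  · have m' : (m : ℝ) ≤ _ := Int.cast_le.2 m6
    push_cast at m' k0 k1 k2; linarith
  · have m' : (m : ℝ) ≤ _ := Int.cast_le.2 m7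
    push_cast at m' k0 k1 k2; linarith
  · have m' : (m : ℝ) ≤ _ := Int.cast_le.2 m8
    push_cast at m' k0 k1 k2; linarith

/-- The box around the left-hand cylinder at height `h`. -/
def leftBoxHull (h : ℤ) : List IntVec := boxHull (-120, 0, 24 * h - 24) (-72, 24, 24 * h + 24)

/-- The box around the right-hand cylinder at height `-h`. -/
def rightBoxHull (h : ℤ) : List IntVec := boxHull (72, 0, -24 * h - 24) (120, 24, -24 * h + 24)

/-- The translation by `d` in the `z`-direction. -/
def lift (d : ℝ) (p : R3) : R3 := !₂[p 0, p 1, p 2 + d]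

/-- A point of the box at an intermediate height is a convex combination of its translates into the
boxes at the two end heights. So avoiding the moving box has the same form as separating two moving
pieces. -/
theorem lineMap_lift (p : R3) {t b₀ b₁ b : ℝ} (hb : b = (1 - t) * b₀ + t * b₁) :
    (1 - t) • lift (b₀ - b) p + t • lift (b₁ - b) p = p := by
  ext m
  fin_cases m <;> simp [lift]
  · ring
  · ring
  · rw [hb]; ring

theorem inHull_leftBoxHull (h : ℤ) {b : ℝ} {p : R3} (hp : InLeftBox b p) :
    InHull (leftBoxHull h) (lift (h - b) p) := by
  obtain ⟨⟨_, _⟩, ⟨_, _⟩, _, _⟩ := hp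
  apply inHull_boxHull <;> simp [lift] <;> linarith

theorem inHull_rightBoxHull (h : ℤ) {b : ℝ} {p : R3} (hp : InRightBox b p) :
    InHull (rightBoxHull h) (lift (-h - -b) p) := by
  obtain ⟨⟨_, _⟩, ⟨_, _⟩, _, _⟩ := hp
  apply inHull_boxHull <;> simp [lift] <;> linarith

/-- Some functional in `F` separates `H₀` from `H₀'` and `H₁` from `H₁'`. -/
def Separated (F H₀ H₁ H₀' H₁' : List IntVec) : Prop :=
  ∃ c ∈ F, (∀ p ∈ H₀, ∀ q ∈ H₀', intDot c p < intDot c q) ∧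
    ∀ p ∈ H₁, ∀ q ∈ H₁', intDot c p < intDot c q

instance (F H₀ H₁ H₀' H₁' : List IntVec) : Decidable (Separated F H₀ H₁ H₀' H₁') := by
  unfold Separated; infer_instance

/-- As the same functional separates at both ends, its two strict inequalities combine convexly. -/
theorem Separated.lineMap_ne {F H₀ H₁ H₀' H₁' : List IntVec} (h : Separated F H₀ H₁ H₀' H₁')
    {x₀ x₁ y₀ y₁ : R3} (hx₀ : InHull H₀ x₀) (hx₁ : InHull H₁ x₁) (hy₀ : InHull H₀' y₀)
    (hy₁ : InHull H₁' y₁) {t : ℝ} (ht : t ∈ Set.Icc (0 : ℝ) 1) :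
    (1 - t) • x₀ + t • x₁ ≠ (1 - t) • y₀ + t • y₁ := by
  obtain ⟨c, -, h0, h1⟩ := h
  intro he
  have h2 := hx₀.pairing_lt hy₀ h0
  have h3 := hx₁.pairing_lt hy₁ h1
  have h4 := congrArg (pairing c) he
  simp only [map_add, map_smul, smul_eq_mul] at h4
  rcases ht.1.eq_or_lt with h5 | h5
  · subst h5; linarith
  · nlinarith [mul_lt_mul_of_pos_left h3 h5,
      mul_le_mul_of_nonneg_left h2.le (sub_nonneg.2 ht.2)]

/-- Some functional in `F` is positive on all given vectors. -/
def HasCommonDirection (F V : List IntVec) : Prop := ∃ c ∈ F, ∀ v ∈ V, 0 < intDot c v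

instance (F V : List IntVec) : Decidable (HasCommonDirection F V) := by
  unfold HasCommonDirection; infer_instance

/-- The functionals in `F` show that the straight-line homotopy between curves with arcs in `P₀`
and `P₁` and strands at heights `h₀` and `h₁` is an isotopy. -/
structure Certifies (F : List IntVec) (h₀ h₁ : ℤ) (P₀ P₁ : Fin 4 → Fin 11 → Piece) : Prop where
  distinct_arcs : ∀ i j : Fin 4, i < j → ∀ k l : Fin 11,
    Separated F (P₀ i k).hull (P₁ i k).hull (P₀ j l).hull (P₁ j l).hull
  distant_pieces : ∀ i : Fin 4, ∀ k l : Fin 11, (k : ℕ) + 1 < l →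
    Separated F (P₀ i k).hull (P₁ i k).hull (P₀ i l).hull (P₁ i l).hull
  adjacent_pieces : ∀ i : Fin 4, ∀ k : Fin 10, HasCommonDirection F
    ((P₀ i k.castSucc).vel ++ (P₁ i k.castSucc).vel ++ (P₀ i k.succ).vel ++ (P₁ i k.succ).vel)
  left_box : ∀ i : Fin 4, ∀ k : Fin 11, k ≠ 0 → k ≠ 10 →
    Separated F (P₀ i k).hull (P₁ i k).hull (leftBoxHull h₀) (leftBoxHull h₁)
  right_box : ∀ i : Fin 4, ∀ k : Fin 11, k ≠ 0 → k ≠ 10 →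
    Separated F (P₀ i k).hull (P₁ i k).hull (rightBoxHull h₀) (rightBoxHull h₁)

theorem exists_piece {s : ℝ} (hs : s ∈ Set.Icc (0 : ℝ) 5) :
    ∃ k : Fin 11, |2 * s - (k : ℕ)| ≤ 1 / 2 := by
  have h0 : (0 : ℝ) ≤ 2 * s + 1 / 2 := by linarith [hs.1]
  refine ⟨⟨⌊2 * s + 1 / 2⌋₊, (Nat.floor_lt h0).2 ?_⟩, abs_le.2 ⟨?_, ?_⟩⟩
  · push_cast; linarith [hs.2]
  · have := Nat.floor_le h0; dsimp only; linarith
  · have := Nat.lt_floor_add_one (2 * s + 1 / 2); dsimp only; linarith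

/-- Outside [0, 1] the strands are vertical rays, which leave the box through its top or bottom. -/
theorem linkPiece_not_mem_box (J : StringLink) (h : ℝ) (i : Fin 4) {τ : ℝ} (hτ : τ < 0 ∨ 1 < τ) :
    ¬ InLeftBox h (linkPiece J h i τ) ∧ ¬ InRightBox h (linkPiece J h i τ) := by
  have h1 : ∀ j, J.strand j τ 1 = τ := fun j => by
    rw [J.vertical j τ (hτ.imp le_of_lt le_of_lt)]; simp
  have h2 : ∀ j, J.strand j (1 - τ) 1 = 1 - τ := fun j => by
    rw [J.vertical j (1 - τ) (by rcases hτ with h | h; right; linarith; left; linarith)]; simp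
  have h3 : ¬ (0 ≤ linkPiece J h i τ 1 ∧ linkPiece J h i τ 1 ≤ 1) := by
    rintro ⟨h4, h5⟩
    fin_cases i <;> simp [linkPiece, flipMap, mirrorMap, h1, h2] at h4 h5 <;>
      rcases hτ with h | h <;> linarith
  exact ⟨fun h => h3 h.2.1, fun h => h3 h.2.1⟩

theorem Decomposes.arc_start {J : StringLink} {γ : ℝ → R3} {h : ℝ} {a : Fin 4 → ℝ → R3}
    (hd : Decomposes J γ h a) (i : Fin 4) {s : ℝ} (hs : s ∈ Set.Icc (0 : ℝ) (1 / 4)) :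
    a i s = linkPiece J h i (1 + s) := by
  rw [← hd.on_arc i s ⟨hs.1, by linarith [hs.2]⟩,
    ← hd.on_piece i (1 + s) ⟨by linarith [hs.1], by linarith [hs.2]⟩]
  congr 1; ring

theorem Decomposes.arc_finish {J : StringLink} {γ : ℝ → R3} {h : ℝ} {a : Fin 4 → ℝ → R3}
    (hd : Decomposes J γ h a) (i : Fin 4) {s : ℝ} (hs : s ∈ Set.Icc (19 / 4 : ℝ) 5) :
    a i s = linkPiece J h (i + 1) (s - 5) := by
  rw [← hd.on_arc i s ⟨by linarith [hs.1], hs.2⟩,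
    ← hd.on_piece (i + 1) (s - 5) ⟨by linarith [hs.1], by linarith [hs.2]⟩]
  by_cases hi : i = 3
  · subst hi
    rw [hd.eq_sub_int _ 1]
    congr 1
    simp only [show (3 : Fin 4) + 1 = 0 from rfl]
    norm_num; ring
  · have : ((i + 1 : Fin 4) : ℕ) = (i : ℕ) + 1 := by
      revert hi; revert i; decide
    rw [this]
    congr 1
    push_cast; ring

/-- Points on different arcs, or on non-adjacent pieces of one arc, are kept apart by separating
functionals. On two adjacent pieces some functional has positive derivative along the curve, which
gives both injectivity and immersion. -/
theorem Certifies.isKnot {J : StringLink} {γ₀ γ₁ : ℝ → R3} {h₀ h₁ : ℤ}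
    {a₀ a₁ : Fin 4 → ℝ → R3} {F : List IntVec} {P₀ P₁ : Fin 4 → Fin 11 → Piece}
    (hc : Certifies F h₀ h₁ P₀ P₁) (hd₀ : Decomposes J γ₀ h₀ a₀) (hd₁ : Decomposes J γ₁ h₁ a₁)
    (ht₀ : ∀ i, Tracks (a₀ i) (P₀ i)) (ht₁ : ∀ i, Tracks (a₁ i) (P₁ i)) {t : ℝ}
    (ht : t ∈ Set.Icc (0 : ℝ) 1) : IsKnot (fun s => (1 - t) • γ₀ s + t • γ₁ s) := by
  have hd := hd₀.lineMap hd₁ t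
  have hderiv : ∀ i s, HasDerivAt (fun s => (1 - t) • a₀ i s + t • a₁ i s)
      ((1 - t) • deriv (a₀ i) s + t • deriv (a₁ i) s) s := fun i s =>
    (((hd₀.smooth_arc i).differentiable (by simp) s).hasDerivAt.const_smul (1 - t)).add
      (((hd₁.smooth_arc i).differentiable (by simp) s).hasDerivAt.const_smul t)
  have convex_pos : ∀ x y : ℝ, 0 < x → 0 < y → 0 < (1 - t) * x + t * y := fun x y hx hy => by
    rcases ht.1.eq_or_lt with h5 | h5
    · subst h5; linarith
    · nlinarith [mul_pos h5 hy, mul_nonneg (sub_nonneg.2 ht.2) hx.le]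
  have hdir : ∀ (i : Fin 4) (k : Fin 10), ∃ c : IntVec, ∀ s ∈ Set.Icc (0 : ℝ) 5,
      (k : ℕ) - 1 / 2 ≤ 2 * s → 2 * s ≤ (k : ℕ) + 3 / 2 →
      0 < pairing c ((1 - t) • deriv (a₀ i) s + t • deriv (a₁ i) s) := by
    intro i k
    obtain ⟨c, -, hv⟩ := hc.adjacent_pieces i k
    simp only [List.mem_append] at hv
    refine ⟨c, fun s hs h1 h2 => ?_⟩
    simp only [map_add, map_smul, smul_eq_mul]
    rcases le_total (2 * s) ((k : ℕ) + 1 / 2) with h3 | h3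
    · have h4 : |2 * s - ((k.castSucc : Fin 11) : ℕ)| ≤ 1 / 2 := by
        simp only [Fin.val_castSucc]; exact abs_le.2 ⟨by linarith, by linarith⟩
      exact convex_pos _ _ ((ht₀ i).vel _ s hs h4 c fun q hq => hv q (by simp [hq]))
        ((ht₁ i).vel _ s hs h4 c fun q hq => hv q (by simp [hq]))
    · have h4 : |2 * s - ((k.succ : Fin 11) : ℕ)| ≤ 1 / 2 := by
        simp only [Fin.val_succ, Nat.cast_add, Nat.cast_one]
        exact abs_le.2 ⟨by linarith, by linarith⟩
      exact convex_pos _ _ ((ht₀ i).vel _ s hs h4 c fun q hq => hv q (by simp [hq]))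
        ((ht₁ i).vel _ s hs h4 c fun q hq => hv q (by simp [hq]))
  have hclose : ∀ (i : Fin 4) (k : Fin 10) (s s' : ℝ), s ∈ Set.Icc (0 : ℝ) 5 →
      s' ∈ Set.Icc (0 : ℝ) 5 → (k : ℕ) - 1 / 2 ≤ 2 * s → 2 * s ≤ (k : ℕ) + 3 / 2 →
      (k : ℕ) - 1 / 2 ≤ 2 * s' → 2 * s' ≤ (k : ℕ) + 3 / 2 →
      (1 - t) • a₀ i s + t • a₁ i s = (1 - t) • a₀ i s' + t • a₁ i s' → s = s' := by
    intro i k s s' hs hs' h1 h2 h3 h4 he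
    obtain ⟨c, hpos⟩ := hdir i k
    have hφ : ∀ s, HasDerivAt (fun s => pairing c ((1 - t) • a₀ i s + t • a₁ i s))
        (pairing c ((1 - t) • deriv (a₀ i) s + t • deriv (a₁ i) s)) s := fun s =>
      (pairing c).hasFDerivAt.comp_hasDerivAt s (hderiv i s)
    have hmono : StrictMonoOn (fun s => pairing c ((1 - t) • a₀ i s + t • a₁ i s))
        (Set.Icc (max 0 (((k : ℕ) - 1 / 2) / 2)) (min 5 (((k : ℕ) + 3 / 2) / 2))) := by
      refine strictMonoOn_of_deriv_pos (convex_Icc _ _)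
        (fun s _ => (hφ s).continuousAt.continuousWithinAt) fun s hs => ?_
      have hs := interior_subset hs
      rw [(hφ s).deriv]
      have h5 := max_le_iff.1 hs.1
      have h6 := le_min_iff.1 hs.2
      exact hpos s ⟨h5.1, h6.1⟩ (by linarith) (by linarith)
    exact hmono.injOn ⟨max_le hs.1 (by linarith), le_min hs.2 (by linarith)⟩
      ⟨max_le hs'.1 (by linarith), le_min hs'.2 (by linarith)⟩ (by simp only [he])
  have hfar : ∀ (i : Fin 4) (k l : Fin 11) (s s' : ℝ), s ∈ Set.Icc (0 : ℝ) 5 →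
      s' ∈ Set.Icc (0 : ℝ) 5 → |2 * s - (k : ℕ)| ≤ 1 / 2 → |2 * s' - (l : ℕ)| ≤ 1 / 2 → k ≤ l →
      (1 - t) • a₀ i s + t • a₁ i s = (1 - t) • a₀ i s' + t • a₁ i s' → s = s' := by
    intro i k l s s' hs hs' h1 h2 hkl he
    rcases lt_or_ge ((k : ℕ) + 1) (l : ℕ) with h3 | h3
    · exact absurd he ((hc.distant_pieces i k l h3).lineMap_ne ((ht₀ i).pos k s hs h1)
        ((ht₁ i).pos k s hs h1) ((ht₀ i).pos l s' hs' h2) ((ht₁ i).pos l s' hs' h2) ht)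
    have h1' := abs_le.1 h1
    have h2' := abs_le.1 h2
    have h3' : ((l : ℕ) : ℝ) ≤ (k : ℕ) + 1 := by exact_mod_cast h3
    have hkl' : ((k : ℕ) : ℝ) ≤ (l : ℕ) := by exact_mod_cast hkl
    rcases lt_or_ge (k : ℕ) 10 with h4 | h4
    · exact hclose i ⟨k, h4⟩ s s' hs hs' (by dsimp only; linarith) (by dsimp only; linarith)
        (by dsimp only; linarith) (by dsimp only; linarith) he
    -- There are only ten adjacent pairs; the last piece is treated as the second member of the pair
    -- starting at 9.
    · have h5 : (k : ℕ) = 10 := by omega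
      have h6 : (l : ℕ) = 10 := by omega
      rw [h5] at h1'
      rw [h6] at h2'
      push_cast at h1' h2'
      exact hclose i ⟨9, by norm_num⟩ s s' hs hs' (by norm_num; linarith) (by norm_num; linarith)
        (by norm_num; linarith) (by norm_num; linarith) he
  have hdist : ∀ (i j : Fin 4) (s s' : ℝ), i < j → s ∈ Set.Icc (0 : ℝ) 5 →
      s' ∈ Set.Icc (0 : ℝ) 5 →
      (1 - t) • a₀ i s + t • a₁ i s ≠ (1 - t) • a₀ j s' + t • a₁ j s' := by
    intro i j s s' hij hs hs'
    obtain ⟨k, hk⟩ := exists_piece hs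
    obtain ⟨l, hl⟩ := exists_piece hs'
    exact (hc.distinct_arcs i j hij k l).lineMap_ne ((ht₀ i).pos k s hs hk)
        ((ht₁ i).pos k s hs hk) ((ht₀ j).pos l s' hs' hl) ((ht₁ j).pos l s' hs' hl) ht
  refine hd.isKnot ?_ ?_ ?_
  · intro i s hs
    have hs := Set.Ioo_subset_Icc_self hs
    obtain ⟨k, hk⟩ := exists_piece hs
    have hk := abs_le.1 hk
    obtain ⟨k', hk1, hk2⟩ : ∃ k' : Fin 10, ((k' : ℕ) : ℝ) - 1 / 2 ≤ 2 * s ∧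
        2 * s ≤ (k' : ℕ) + 3 / 2 := by
      rcases lt_or_ge (k : ℕ) 10 with h4 | h4
      · exact ⟨⟨k, h4⟩, by dsimp only; linarith, by dsimp only; linarith⟩
      · have h5 : (k : ℕ) = 10 := by omega
        rw [h5] at hk
        push_cast at hk
        exact ⟨⟨9, by norm_num⟩, by norm_num; linarith, by norm_num; linarith⟩
    obtain ⟨c, hpos⟩ := hdir i k'
    have := hpos s hs hk1 hk2
    rw [(hderiv i s).deriv]
    intro h0
    rw [h0, map_zero] at this
    exact this.false
  · intro i j s hs s' hs' he
    have hs := Set.Ioo_subset_Icc_self hs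
    have hs' := Set.Ioo_subset_Icc_self hs'
    rcases lt_trichotomy i j with hij | hij | hij
    · exact absurd he (hdist i j s s' hij hs hs')
    · subst hij
      obtain ⟨k, hk⟩ := exists_piece hs
      obtain ⟨l, hl⟩ := exists_piece hs'
      rcases le_total k l with hkl | hkl
      · exact ⟨rfl, hfar i k l s s' hs hs' hk hl hkl he⟩
      · exact ⟨rfl, (hfar i l k s' s hs' hs hl hk hkl he.symm).symm⟩
    · exact absurd he.symm (hdist j i s' s hij hs' hs)
  · intro i s hs
    -- The end pieces touch the boxes and cannot be separated from them, but there the arc continues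
    -- a strand vertically.
    rcases le_or_gt s (1 / 4) with h1 | h1
    · have := hd.arc_start i ⟨hs.1.le, h1⟩
      rw [this]
      exact linkPiece_not_mem_box J _ i (Or.inr (by linarith [hs.1]))
    rcases le_or_gt (19 / 4) s with h2 | h2
    · have := hd.arc_finish i ⟨h2, hs.2.le⟩
      rw [this]
      exact linkPiece_not_mem_box J _ _ (Or.inl (by linarith [hs.2]))
    have hs := Set.Ioo_subset_Icc_self hs
    obtain ⟨k, hk⟩ := exists_piece hs
    have hk' := abs_le.1 hk
    have hk0 : k ≠ 0 := by rintro rfl; norm_num at hk'; linarith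
    have hk1 : k ≠ 10 := by rintro rfl; norm_num at hk'; linarith
    refine ⟨fun hb => ?_, fun hb => ?_⟩
    · exact (hc.left_box i k hk0 hk1).lineMap_ne ((ht₀ i).pos k s hs hk) ((ht₁ i).pos k s hs hk)
        (inHull_leftBoxHull h₀ hb) (inHull_leftBoxHull h₁ hb) ht (lineMap_lift _ rfl).symm
    · exact (hc.right_box i k hk0 hk1).lineMap_ne ((ht₀ i).pos k s hs hk) ((ht₁ i).pos k s hs hk)
        (inHull_rightBoxHull h₀ hb) (inHull_rightBoxHull h₁ hb) ht
        (lineMap_lift _ (by ring)).symm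

theorem Certifies.isotopic {J : StringLink} {γ₀ γ₁ : ℝ → R3} {h₀ h₁ : ℤ}
    {a₀ a₁ : Fin 4 → ℝ → R3} {F : List IntVec} {P₀ P₁ : Fin 4 → Fin 11 → Piece}
    (hc : Certifies F h₀ h₁ P₀ P₁) (hd₀ : Decomposes J γ₀ h₀ a₀) (hd₁ : Decomposes J γ₁ h₁ a₁)
    (ht₀ : ∀ i, Tracks (a₀ i) (P₀ i)) (ht₁ : ∀ i, Tracks (a₁ i) (P₁ i)) : Isotopic γ₀ γ₁ := by
  refine ⟨fun t s => (1 - t) • γ₀ s + t • γ₁ s, ?_, fun t ht => hc.isKnot hd₀ hd₁ ht₀ ht₁ ht,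
    by simp, by simp⟩
  have h0 : ContDiff ℝ ∞ fun p : ℝ × ℝ => γ₀ p.2 := hd₀.contDiff.comp contDiff_snd
  have h1 : ContDiff ℝ ∞ fun p : ℝ × ℝ => γ₁ p.2 := hd₁.contDiff.comp contDiff_snd
  exact (((contDiff_const.sub contDiff_fst).smul h0).add (contDiff_fst.smul h1)).contDiffOn


/-! ### Integer data for the figure and the standard position. -/

/-- The bounds for the polygon with vertices `p`, `q`, `r` near the vertex `q`. Here the vertices
are given in units of `1/12`. -/
def cornerPiece (p q r : IntVec) : Piece := ⟨[p + q, q + q, q + r], [q - p, r - q]⟩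

/-- The bounds for the polygon with vertices `w 0, …, w 10` (in units of `1/12`). -/
def polygonPieces (w : ℕ → IntVec) (k : Fin 11) : Piece :=
  if k = 0 then ⟨[w 0 + w 0, w 0 + w 1], [w 1 - w 0]⟩
  else if k = 10 then ⟨[w 9 + w 10, w 10 + w 10], [w 10 - w 9]⟩
  else cornerPiece (w (k - 1)) (w k) (w (k + 1))

/-- The list of points, continued by zeros. -/
def vertices (l : List IntVec) (k : ℕ) : IntVec := l.getD k 0

/-- The polygon with vertices `v` (in units of `1/6`) with the midpoints of its edges as additional
vertices (in units of `1/12`). -/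
def subdivide (v : ℕ → IntVec) (k : ℕ) : IntVec := v (k / 2) + v ((k + 1) / 2)

/-- The vertices of the four arcs of the figure, in units of `1/6`. -/
def figureVertices (i : Fin 4) : ℕ → IntVec :=
  vertices <| match i with
  | 0 => [(-27, 6, 6), (-27, 12, 6), (-18, 24, 6), (12, -6, 6), (21, -6, -6), (21, 0, -6)]
  | 1 => [(21, 6, -6), (21, 12, -6), (-6, -6, -6), (6, -6, 6), (-21, 12, 6), (-21, 6, 6)]
  | 2 => [(-21, 0, 6), (-21, -6, 6), (-12, -6, -6), (18, 24, -6), (27, 12, -6), (27, 6, -6)]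
  | 3 => [(27, 0, -6), (27, -6, -6), (21, -12, -6), (-21, -12, 6), (-27, -6, 6), (-27, 0, 6)]

/-- The vertices of the outer arc of the standard position before it is twisted, in units of `1/12`. -/
def outerVertices : ℕ → IntVec :=
  vertices [(-54, 12, 0), (-54, 18, 0), (-54, 36, 0), (-24, 36, 0), (-8, 36, 0), (0, 36, 0),
    (8, 36, 0), (24, 36, 0), (42, 36, 0), (42, 18, 0), (42, 12, 0)]

/-- The vertices of the middle arc of the standard position, in units of `1/12`. -/
def middleVertices : ℕ → IntVec :=
  vertices [(42, 12, 0), (42, 18, 0), (30, 18, 0), (24, 6, 0), (12, 6, 0), (0, 6, 0),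
    (-12, 6, 0), (-24, 6, 0), (-30, 18, 0), (-42, 18, 0), (-42, 12, 0)]

/-- The vertices of the lower arc of the standard position, in units of `1/12`. -/
def lowerVertices : ℕ → IntVec :=
  vertices [(54, 0, 0), (54, -6, 0), (72, 6, 0), (96, 6, 0), (96, -96, 0), (0, -120, 0),
    (-96, -96, 0), (-96, 6, 0), (-72, 6, 0), (-54, -6, 0), (-54, 0, 0)]

/-- The half turn about the line `y = 1/2`, `z = 0`, in units of `1/12`. -/
def halfTurnVec (p : IntVec) : IntVec := (p.1, 12 - p.2.1, -p.2.2)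

/-- The flip `(x, y, z) ↦ (-x, y, -z)`. -/
def flipVec (p : IntVec) : IntVec := (-p.1, p.2.1, -p.2.2)

/-- The bounds for the flip of a curve run through backwards. -/
def flipPiece (P : Piece) : Piece := ⟨P.hull.map flipVec, P.vel.map fun v => -flipVec v⟩

/-- The edges of a cone that contains the velocity of the twisted part of the outer arc. -/
def twistVel : List IntVec := [(1, 10, 10), (1, 10, -10), (1, -10, 10), (1, -10, -10)]

/-- The bounds for the twisted outer arc. -/
def twistedPieces (k : Fin 11) : Piece :=
  if k < 4 then polygonPieces outerVertices k
  else if k = 4 then ⟨boxHull (-32, 42, 0) (-8, 72, 60), twistVel⟩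
  else if k = 5 then ⟨boxHull (-8, -18, 48) (8, 42, 60), twistVel⟩
  else if k = 6 then ⟨boxHull (8, -48, 0) (32, -18, 60), twistVel⟩
  else polygonPieces (fun k => halfTurnVec (outerVertices k)) k

/-- The bounds for the arcs of the figure. -/
def figurePieces (i : Fin 4) : Fin 11 → Piece := polygonPieces (subdivide (figureVertices i))

/-- The bounds for the arcs of the standard position. -/
def standardPieces (i : Fin 4) : Fin 11 → Piece :=
  match i with
  | 0 => twistedPieces
  | 1 => polygonPieces middleVertices
  | 2 => fun k => flipPiece (twistedPieces k.rev)
  | 3 => polygonPieces lowerVertices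

/-- Functionals that separate the arcs throughout the straight-line homotopy from the figure to the
standard position. -/
def functionals : List IntVec :=
  [(4, -1, -2), (-4, -3, 0), (-1, 3, 0), (0, -5, -1), (1, 1, -4), (1, 0, 0), (-3, -1, 4),
    (-4, 1, -1), (3, -4, 0), (3, 4, 0), (-1, -2, -5), (-1, 1, -1), (1, 3, 0), (-1, 1, 0),
    (-4, -1, 0), (1, -5, 4), (1, 5, 4)]

-- All hulls and velocity cones are finite lists of integer vectors, so this is a finite
-- computation.
set_option maxRecDepth 100000 in
theorem certifies_standard : Certifies functionals 1 0 figurePieces standardPieces where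
  distinct_arcs := by decide +kernel
  distant_pieces := by decide +kernel
  adjacent_pieces := by decide +kernel
  left_box := by decide +kernel
  right_box := by decide +kernel

/-! ### Rounded polygons -/

/-- The path through the points `v 0, …, v (n + 1)` with rounded corners. -/
def polyPath (v : ℕ → R3) : ℕ → ℝ → R3
  | 0, s => v 0 + s • (v 1 - v 0)
  | n + 1, s => polyPath v n s
      + ramp (s - (n + 1 : ℕ)) • ((v (n + 2) - v (n + 1)) - (v (n + 1) - v n))

theorem roundedPath_eq_polyPath {v : Fin 6 → R3} {u : ℕ → R3} (h : ∀ k : Fin 6, v k = u k) :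
    roundedPath v = polyPath u 4 := by
  funext s
  have h0 := h 0; have h1 := h 1; have h2 := h 2; have h3 := h 3; have h4 := h 4; have h5 := h 5
  simp only [Fin.isValue, Fin.val_zero, Fin.val_one, Fin.val_two] at h0 h1 h2
  simp only [roundedPath, polyPath, h0, h1, h2, h3, h4, h5]
  norm_num

theorem contDiff_polyPath (v : ℕ → R3) (n : ℕ) : ContDiff ℝ ∞ (polyPath v n) := by
  induction n with
  | zero => exact contDiff_const.add (contDiff_id.smul contDiff_const)
  | succ n ih =>
    exact ih.add ((contDiff_ramp.comp (contDiff_id.sub contDiff_const)).smul contDiff_const)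

/-- Past a corner its `ramp` is linear, and the second differences telescope to the current edge
vector. -/
theorem polyPath_of_ge (v : ℕ → R3) (n : ℕ) {s : ℝ} (hs : (n : ℝ) + 1 / 4 ≤ s) :
    polyPath v n s = v n + (s - n) • (v (n + 1) - v n) := by
  induction n with
  | zero => simp [polyPath]
  | succ n ih =>
    push_cast at hs
    rw [polyPath, ih (by linarith), ramp_of_ge (by push_cast; linarith)]
    push_cast
    module

theorem polyPath_of_le (v : ℕ → R3) {n m : ℕ} (hnm : n ≤ m) {s : ℝ} (hs : s ≤ n + 3 / 4) :
    polyPath v m s = polyPath v n s := by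
  induction m, hnm using Nat.le_induction with
  | base => rfl
  | succ m hm ih =>
    have : (n : ℝ) ≤ m := by exact_mod_cast hm
    rw [polyPath, ih, ramp_of_le (by push_cast; linarith), zero_smul, add_zero]

theorem polyPath_start (v : ℕ → R3) (m : ℕ) {s : ℝ} (hs : s ≤ 3 / 4) :
    polyPath v m s = v 0 + s • (v 1 - v 0) :=
  polyPath_of_le v (Nat.zero_le m) (by simpa using hs)

theorem polyPath_straight (v : ℕ → R3) {k m : ℕ} (hk : k ≤ m) {s : ℝ} (h0 : (k : ℝ) + 1 / 4 ≤ s)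
    (h1 : s ≤ k + 3 / 4) : polyPath v m s = v k + (s - k) • (v (k + 1) - v k) := by
  rw [polyPath_of_le v hk h1, polyPath_of_ge v k h0]

/-- In this form the path is the vertex displaced along its two edges with nonnegative weights, as
`inHull_corner` needs. -/
theorem polyPath_corner (v : ℕ → R3) {k m : ℕ} (hk : k < m) {s : ℝ}
    (h0 : |s - (k + 1 : ℕ)| ≤ 3 / 4) :
    polyPath v m s = v (k + 1) - ramp (-(s - (k + 1 : ℕ))) • (v (k + 1) - v k)
      + ramp (s - (k + 1 : ℕ)) • (v (k + 2) - v (k + 1)) := by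
  have h0 := abs_le.1 h0
  push_cast at h0
  rw [polyPath_of_le v (Nat.succ_le_of_lt hk) (by push_cast; linarith), polyPath,
    polyPath_of_ge v k (by linarith), ramp_neg]
  push_cast
  module

/-- The velocity of `polyPath`. -/
def polyVel (v : ℕ → R3) : ℕ → ℝ → R3
  | 0, _ => v 1 - v 0
  | n + 1, s => polyVel v n s + Real.smoothTransition (2 * (s - (n + 1 : ℕ)) + 1 / 2) •
      ((v (n + 2) - v (n + 1)) - (v (n + 1) - v n))

theorem hasDerivAt_polyPath (v : ℕ → R3) (n : ℕ) (s : ℝ) :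
    HasDerivAt (polyPath v n) (polyVel v n s) s := by
  induction n with
  | zero => simpa [polyPath, polyVel] using
      ((hasDerivAt_id s).smul_const (v 1 - v 0)).const_add (v 0)
  | succ n ih =>
    have hr := (hasDerivAt_ramp (s - (n + 1 : ℕ))).comp s ((hasDerivAt_id s).sub_const _)
    rw [mul_one] at hr
    exact ih.add (hr.smul_const _)

theorem polyVel_of_ge (v : ℕ → R3) (n : ℕ) {s : ℝ} (hs : (n : ℝ) + 1 / 4 ≤ s) :
    polyVel v n s = v (n + 1) - v n := by
  induction n with
  | zero => rfl
  | succ n ih =>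
    push_cast at hs
    rw [polyVel, ih (by linarith), Real.smoothTransition.one_of_one_le (by push_cast; linarith),
      one_smul, add_sub_cancel]

theorem polyVel_of_le (v : ℕ → R3) {n m : ℕ} (hnm : n ≤ m) {s : ℝ} (hs : s ≤ n + 3 / 4) :
    polyVel v m s = polyVel v n s := by
  induction m, hnm using Nat.le_induction with
  | base => rfl
  | succ m hm ih =>
    have : (n : ℝ) ≤ m := by exact_mod_cast hm
    rw [polyVel, ih, Real.smoothTransition.zero_of_nonpos (by push_cast; linarith), zero_smul,
      add_zero]

theorem polyVel_start (v : ℕ → R3) (m : ℕ) {s : ℝ} (hs : s ≤ 3 / 4) :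
    polyVel v m s = v 1 - v 0 :=
  polyVel_of_le v (Nat.zero_le m) (by simpa using hs)

theorem polyVel_straight (v : ℕ → R3) {k m : ℕ} (hk : k ≤ m) {s : ℝ} (h0 : (k : ℝ) + 1 / 4 ≤ s)
    (h1 : s ≤ k + 3 / 4) : polyVel v m s = v (k + 1) - v k := by
  rw [polyVel_of_le v hk h1, polyVel_of_ge v k h0]

theorem polyVel_corner (v : ℕ → R3) {k m : ℕ} (hk : k < m) {s : ℝ}
    (h0 : |s - (k + 1 : ℕ)| ≤ 3 / 4) : ∃ σ ∈ Set.Icc (0 : ℝ) 1,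
      polyVel v m s = (1 - σ) • (v (k + 1) - v k) + σ • (v (k + 2) - v (k + 1)) := by
  refine ⟨Real.smoothTransition (2 * (s - (k + 1 : ℕ)) + 1 / 2),
    ⟨Real.smoothTransition.nonneg _, Real.smoothTransition.le_one _⟩, ?_⟩
  have h0 := abs_le.1 h0
  push_cast at h0
  rw [polyVel_of_le v (Nat.succ_le_of_lt hk) (by push_cast; linarith), polyVel,
    polyVel_of_ge v k (by linarith)]
  module

/-- The point with coordinates `p` in units of `1/n`. -/
def scaled (n : ℝ) (p : IntVec) : R3 := !₂[p.1 / n, p.2.1 / n, p.2.2 / n]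

theorem scaled_sub (n : ℝ) (p q : IntVec) : scaled n (p - q) = scaled n p - scaled n q := by
  ext i; fin_cases i <;> simp [scaled, sub_div]

theorem scaled_add (n : ℝ) (p q : IntVec) : scaled n (p + q) = scaled n p + scaled n q := by
  ext i; fin_cases i <;> simp [scaled, add_div]

theorem scaled_six (p : IntVec) : scaled 6 p = (2 : ℝ) • scaled 12 p := by
  ext i; fin_cases i <;> simp [scaled] <;> ring

theorem pairing_scaled (c : IntVec) (n : ℝ) (p : IntVec) :
    pairing c (scaled n p) = intDot c p / n := by
  rw [pairing_apply]; simp [scaled, intDot]; ring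

theorem intDot_add (c p q : IntVec) : intDot c (p + q) = intDot c p + intDot c q := by
  simp only [intDot, Prod.fst_add, Prod.snd_add]; ring

/-- The point is the convex combination, with weights 2α, 1 - 2α - 2β, 2β, of the midpoint of pq,
the vertex q and the midpoint of qr. The sum of two points in units of 1/12 is their midpoint in
units of 1/24. -/
theorem inHull_corner {p q r : IntVec} {α β : ℝ} (hα : 0 ≤ α) (hβ : 0 ≤ β) (hαβ : α + β ≤ 1 / 2) :
    InHull [p + q, q + q, q + r] (scaled 12 q - α • (scaled 12 q - scaled 12 p)
      + β • (scaled 12 r - scaled 12 q)) := by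
  intro c m hm
  simp only [List.mem_cons, List.not_mem_nil, or_false, forall_eq_or_imp, forall_eq,
    intDot_add] at hm
  obtain ⟨h1, h2, h3⟩ := hm
  have h1 : (m : ℝ) ≤ intDot c p + intDot c q := by exact_mod_cast h1
  have h2 : (m : ℝ) ≤ intDot c q + intDot c q := by exact_mod_cast h2
  have h3 : (m : ℝ) ≤ intDot c q + intDot c r := by exact_mod_cast h3
  simp only [map_add, map_sub, map_smul, pairing_scaled, smul_eq_mul]
  nlinarith [mul_le_mul_of_nonneg_left h1 hα, mul_le_mul_of_nonneg_left h3 hβ,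
    mul_le_mul_of_nonneg_left h2 (show 0 ≤ 1 - 2 * α - 2 * β by linarith)]

theorem inHull_edge {p q : IntVec} {β : ℝ} (hβ : 0 ≤ β) (hβ' : β ≤ 1 / 2) :
    InHull [p + p, p + q] (scaled 12 p + β • (scaled 12 q - scaled 12 p)) := by
  have h := inHull_corner (p := p) (q := p) (r := q) le_rfl hβ (by linarith)
  intro c m hm
  simpa using h c m (by simpa using hm)

theorem InHull.perm {H H' : List IntVec} {p : R3} (h : InHull H p) (hH : ∀ q ∈ H, q ∈ H') :
    InHull H' p := fun c m hm => h c m fun q hq => hm q (hH q hq)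

theorem inCone_pair {p q : IntVec} {n x y : ℝ} (hn : 0 < n) (hx : 0 ≤ x) (hy : 0 ≤ y)
    (hxy : 0 < x + y) : InCone [p, q] (x • scaled n p + y • scaled n q) := by
  intro c hc
  simp only [List.mem_cons, List.not_mem_nil, or_false, forall_eq_or_imp, forall_eq] at hc
  obtain ⟨h1, h2⟩ := hc
  have h1 : (0 : ℝ) < intDot c p / n := div_pos (by exact_mod_cast h1) hn
  have h2 : (0 : ℝ) < intDot c q / n := div_pos (by exact_mod_cast h2) hn
  simp only [map_add, map_smul, pairing_scaled, smul_eq_mul]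
  rcases hx.eq_or_lt with h | h
  · subst h
    have : 0 < y := by linarith
    nlinarith [mul_pos this h2]
  · nlinarith [mul_pos h h1, mul_nonneg hy h2.le]

theorem inCone_single {p : IntVec} {n x : ℝ} (hn : 0 < n) (hx : 0 < x) :
    InCone [p] (x • scaled n p) := by
  have h := inCone_pair (p := p) (q := p) hn hx.le le_rfl (by linarith)
  intro c hc
  simpa using h c (by simpa using hc)

theorem Fin.eleven_cases (k : Fin 11) : k = 0 ∨ k = 10 ∨ ∃ j : ℕ, j < 9 ∧ (k : ℕ) = j + 1 := by
  by_cases h0 : k = 0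
  · exact Or.inl h0
  by_cases h1 : k = 10
  · exact Or.inr (Or.inl h1)
  refine Or.inr (Or.inr ⟨k - 1, ?_, ?_⟩) <;> omega

theorem polygonPieces_corner (w : ℕ → IntVec) {k : Fin 11} {j : ℕ} (hj : j < 9)
    (hk : (k : ℕ) = j + 1) : polygonPieces w k = cornerPiece (w j) (w (j + 1)) (w (j + 2)) := by
  have h0 : k ≠ 0 := by rintro rfl; simp at hk
  have h1 : k ≠ 10 := by rintro rfl; simp at hk; omega
  simp [polygonPieces, h0, h1, hk]

/-- At double speed vertex k is passed at time k/2, the centre of the k-th time window. -/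
theorem tracks_polyPath (w : ℕ → IntVec) :
    Tracks (fun s => polyPath (fun k => scaled 12 (w k)) 9 (2 * s)) (polygonPieces w) := by
  have hcomp : ∀ s : ℝ, deriv (fun s => polyPath (fun k => scaled 12 (w k)) 9 (2 * s)) s =
      (2 : ℝ) • polyVel (fun k => scaled 12 (w k)) 9 (2 * s) := by
    intro s
    have h2 : HasDerivAt (fun s : ℝ => 2 * s) 2 s := by simpa using (hasDerivAt_id s).const_mul 2
    exact ((hasDerivAt_polyPath _ _ _).scomp s h2).deriv
  constructor
  · intro k s hs hk
    rcases Fin.eleven_cases k with rfl | rfl | ⟨j, hj, hj'⟩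
    · have hk := abs_le.1 hk
      simp only [Fin.val_zero, Nat.cast_zero, sub_zero] at hk
      rw [polyPath_start _ _ (by linarith)]
      exact inHull_edge (by linarith [hs.1]) (by linarith)
    · have hk := abs_le.1 hk
      norm_num at hk
      rw [polyPath_of_ge _ _ (by norm_num; linarith)]
      -- The last half edge is measured backwards from the final vertex.
      have h := inHull_edge (p := w 10) (q := w 9) (β := 10 - 2 * s) (by linarith [hs.2])
        (by linarith)
      refine InHull.perm (H := [w 10 + w 10, w 10 + w 9]) ?_ (by simp [polygonPieces, add_comm])
      convert h using 1
      push_cast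
      module
    · rw [polygonPieces_corner w hj hj', polyPath_corner _ hj (by rw [← hj']; linarith)]
      rw [hj'] at hk
      exact inHull_corner (ramp_nonneg _) (ramp_nonneg _)
        (by rw [add_comm]; exact ramp_add_ramp_neg_le hk (by norm_num))
  · intro k s hs hk
    rcases Fin.eleven_cases k with rfl | rfl | ⟨j, hj, hj'⟩
    · have hk := abs_le.1 hk
      simp only [Fin.val_zero, Nat.cast_zero, sub_zero] at hk
      rw [hcomp, polyVel_start _ _ (by linarith), ← scaled_sub]
      exact inCone_single (by norm_num) (by norm_num)
    · have hk := abs_le.1 hk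
      norm_num at hk
      rw [hcomp, polyVel_of_ge _ _ (by norm_num; linarith), ← scaled_sub]
      exact inCone_single (by norm_num) (by norm_num)
    · rw [polygonPieces_corner w hj hj']
      rw [hj'] at hk
      obtain ⟨σ, hσ, hd⟩ := polyVel_corner (fun k => scaled 12 (w k)) hj
        (hk.trans (by norm_num))
      rw [hcomp, hd, smul_add, smul_smul, smul_smul, ← scaled_sub, ← scaled_sub]
      exact inCone_pair (by norm_num) (by linarith [hσ.2]) (by linarith [hσ.1]) (by linarith)

theorem subdivide_even (v : ℕ → IntVec) (j : ℕ) : subdivide v (2 * j) = v j + v j := by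
  simp only [subdivide]; congr 2 <;> omega

theorem subdivide_odd (v : ℕ → IntVec) (j : ℕ) : subdivide v (2 * j + 1) = v j + v (j + 1) := by
  simp only [subdivide]; congr 2 <;> omega

/-- With the edge midpoints inserted, six vertices become eleven: odd windows lie on straight edges,
and inner even windows around true corners. -/
theorem tracks_polyPath_subdivide (v : ℕ → IntVec) :
    Tracks (polyPath (fun k => scaled 6 (v k)) 4) (polygonPieces (subdivide v)) := by
  have e0 : subdivide v 0 = v 0 + v 0 := rfl
  have e1 : subdivide v 1 = v 0 + v 1 := rfl
  have e9 : subdivide v 9 = v 4 + v 5 := rfl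
  have e10 : subdivide v 10 = v 5 + v 5 := rfl
  constructor
  · intro k s hs hk
    rcases Fin.eleven_cases k with rfl | rfl | ⟨j, hj, hj'⟩
    · have hk := abs_le.1 hk
      simp only [Fin.val_zero, Nat.cast_zero, sub_zero] at hk
      rw [polyPath_start _ _ (by linarith)]
      have h := inHull_edge (p := subdivide v 0) (q := subdivide v 1) (β := 2 * s)
        (by linarith [hs.1]) (by linarith)
      refine InHull.perm (H := [subdivide v 0 + subdivide v 0, subdivide v 0 + subdivide v 1]) ?_
        (by simp [polygonPieces])
      convert h using 1
      simp only [e0, e1, scaled_add, scaled_six]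
      module
    · have hk := abs_le.1 hk
      norm_num at hk
      rw [polyPath_of_ge _ _ (by norm_num; linarith)]
      have h := inHull_edge (p := subdivide v 10) (q := subdivide v 9) (β := 10 - 2 * s)
        (by linarith [hs.2]) (by linarith)
      refine InHull.perm (H := [subdivide v 10 + subdivide v 10, subdivide v 10 + subdivide v 9]) ?_
        (by simp [polygonPieces, add_comm])
      convert h using 1
      simp only [e9, e10, scaled_add, scaled_six]
      push_cast
      module
    · rw [polygonPieces_corner _ hj hj']
      rw [hj'] at hk
      rcases Nat.even_or_odd' j with ⟨i, rfl | rfl⟩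
      · have hk := abs_le.1 hk
        push_cast at hk
        rw [polyPath_straight _ (show i ≤ 4 by omega) (by linarith) (by linarith)]
        -- The middle vertex is an edge midpoint; only the weight on the side of it where the point
        -- lies is nonzero.
        have h := inHull_corner (p := subdivide v (2 * i)) (q := subdivide v (2 * i + 1))
          (r := subdivide v (2 * i + 2)) (α := max (2 * i + 1 - 2 * s) 0)
          (β := max (2 * s - (2 * i + 1)) 0) (le_max_right _ _) (le_max_right _ _) (by
            rcases le_total (2 * s) (2 * i + 1) with h | h
            · rw [max_eq_left (by linarith), max_eq_right (by linarith)]; linarith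
            · rw [max_eq_right (by linarith), max_eq_left (by linarith)]; linarith)
        refine (congrArg (InHull _) ?_).mpr h
        have ee : subdivide v (2 * i + 2) = v (i + 1) + v (i + 1) := subdivide_even v (i + 1)
        simp only [subdivide_even, subdivide_odd, ee, scaled_add, scaled_six]
        rcases le_total (2 * s) (2 * i + 1) with h | h
        · rw [max_eq_left (sub_nonneg.2 h), max_eq_right (sub_nonpos.2 h)]; module
        · rw [max_eq_right (sub_nonpos.2 h), max_eq_left (sub_nonneg.2 h)]; module
      · have hk : |s - (i + 1 : ℕ)| ≤ 1 / 4 := by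
          have hk := abs_le.1 hk
          push_cast at hk ⊢
          exact abs_le.2 ⟨by linarith, by linarith⟩
        rw [polyPath_corner _ (show i < 4 by omega) (by linarith)]
        -- The weights on full edges sum to at most 1/4. On the half edges of the subdivision they
        -- double, and the bound 1/2 is exactly what is needed.
        have hle := ramp_add_ramp_neg_le hk le_rfl
        have h := inHull_corner (p := subdivide v (2 * i + 1)) (q := subdivide v (2 * i + 2))
          (r := subdivide v (2 * i + 3)) (α := 2 * ramp (-(s - (i + 1 : ℕ))))
          (β := 2 * ramp (s - (i + 1 : ℕ))) (by linarith [ramp_nonneg (-(s - (i + 1 : ℕ)))])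
          (by linarith [ramp_nonneg (s - (i + 1 : ℕ))]) (by linarith)
        refine (congrArg (InHull _) ?_).mpr h
        have ee : subdivide v (2 * i + 2) = v (i + 1) + v (i + 1) := subdivide_even v (i + 1)
        have eo : subdivide v (2 * i + 3) = v (i + 1) + v (i + 2) := subdivide_odd v (i + 1)
        simp only [subdivide_odd, ee, eo, scaled_add, scaled_six]
        module
  · intro k s hs hk
    rcases Fin.eleven_cases k with rfl | rfl | ⟨j, hj, hj'⟩
    · have hk := abs_le.1 hk
      simp only [Fin.val_zero, Nat.cast_zero, sub_zero] at hk
      rw [(hasDerivAt_polyPath _ _ _).deriv, polyVel_start _ _ (by linarith)]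
      have h := inCone_single (p := subdivide v 1 - subdivide v 0) (n := 6) (x := 1)
        (by norm_num) one_pos
      refine (congrArg (InCone _) ?_).mpr h
      simp only [e0, e1, scaled_add, scaled_sub]
      module
    · have hk := abs_le.1 hk
      norm_num at hk
      rw [(hasDerivAt_polyPath _ _ _).deriv, polyVel_of_ge _ _ (by norm_num; linarith)]
      have h := inCone_single (p := subdivide v 10 - subdivide v 9) (n := 6) (x := 1)
        (by norm_num) one_pos
      refine (congrArg (InCone _) ?_).mpr h
      simp only [e9, e10, scaled_add, scaled_sub]
      module
    · rw [polygonPieces_corner _ hj hj']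
      rw [hj'] at hk
      rcases Nat.even_or_odd' j with ⟨i, rfl | rfl⟩
      · have ee : subdivide v (2 * i + 2) = v (i + 1) + v (i + 1) := subdivide_even v (i + 1)
        have hk := abs_le.1 hk
        push_cast at hk
        rw [(hasDerivAt_polyPath _ _ _).deriv,
          polyVel_straight _ (show i ≤ 4 by omega) (by linarith) (by linarith)]
        have h := inCone_pair (p := subdivide v (2 * i + 1) - subdivide v (2 * i))
          (q := subdivide v (2 * i + 2) - subdivide v (2 * i + 1)) (n := 6) (x := 1) (y := 0)
          (by norm_num) zero_le_one le_rfl (by norm_num)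
        refine (congrArg (InCone _) ?_).mpr h
        simp only [subdivide_even, subdivide_odd, scaled_add, scaled_sub]
        module
      · have ee : subdivide v (2 * i + 2) = v (i + 1) + v (i + 1) := subdivide_even v (i + 1)
        have eo : subdivide v (2 * i + 3) = v (i + 1) + v (i + 2) := subdivide_odd v (i + 1)
        have hk : |s - (i + 1 : ℕ)| ≤ 3 / 4 := by
          have hk := abs_le.1 hk
          push_cast at hk ⊢
          exact abs_le.2 ⟨by linarith, by linarith⟩
        obtain ⟨σ, hσ, hd⟩ := polyVel_corner (fun k => scaled 6 (v k)) (show i < 4 by omega) hk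
        rw [(hasDerivAt_polyPath _ _ _).deriv, hd]
        have h := inCone_pair (p := subdivide v (2 * i + 2) - subdivide v (2 * i + 1))
          (q := subdivide v (2 * i + 3) - subdivide v (2 * i + 2)) (n := 6)
          (by norm_num) (sub_nonneg.2 hσ.2) hσ.1 (by norm_num)
        refine (congrArg (InCone _) ?_).mpr h
        simp only [subdivide_odd, ee, eo, scaled_add, scaled_sub]
        module


/-! ### The arcs of the figure -/

/-- This gives the end points that the arcs must meet. On the right x is negated inside the
cylinder, so strand 1 sits at 4 - 1/2 and strand 0 at 4 + 1/2. -/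
theorem linkPiece_vertical (J : StringLink) (h : ℝ) (i : Fin 4) {τ : ℝ} (hτ : τ ≤ 0 ∨ 1 ≤ τ) :
    linkPiece J h i τ = match i with
      | 0 => !₂[-(9 / 2), τ, h]
      | 1 => !₂[7 / 2, τ, -h]
      | 2 => !₂[-(7 / 2), 1 - τ, h]
      | 3 => !₂[9 / 2, 1 - τ, -h] := by
  have h1 := fun j => J.vertical j τ hτ
  have h2 := fun j => J.vertical j (1 - τ)
    (by rcases hτ with h | h; exacts [Or.inr (by linarith), Or.inl (by linarith)])
  ext m
  fin_cases i <;> fin_cases m <;>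
    simp [linkPiece, flipMap, mirrorMap, h1, h2, basePoint] <;> norm_num

/-- The arcs of the figure. -/
def figureArc (i : Fin 4) : ℝ → R3 := polyPath (fun k => scaled 6 (figureVertices i k)) 4

theorem figureArc_eq :
    ![roundedPath arcA, roundedPath arcB, roundedPath arcC, roundedPath arcD] = figureArc := by
  funext i
  fin_cases i
  · refine roundedPath_eq_polyPath fun k => ?_
    fin_cases k <;> simp [arcA, scaled, figureVertices, vertices] <;> norm_num
  · refine roundedPath_eq_polyPath fun k => ?_
    fin_cases k <;> simp [arcB, scaled, figureVertices, vertices] <;> norm_num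
  · refine roundedPath_eq_polyPath fun k => ?_
    fin_cases k <;> simp [arcC, scaled, figureVertices, vertices] <;> norm_num
  · refine roundedPath_eq_polyPath fun k => ?_
    fin_cases k <;> simp [arcD, scaled, figureVertices, vertices] <;> norm_num

theorem fits_figureArc (J : StringLink) : Fits J 1 figureArc where
  start i s h0 h1 := by
    rw [figureArc, polyPath_start _ _ (by linarith), linkPiece_vertical J 1 i (Or.inr (by linarith))]
    ext m
    fin_cases i <;> fin_cases m <;> simp [scaled, figureVertices, vertices] <;> ring
  finish i s h0 h1 := by
    rw [figureArc, polyPath_of_ge _ _ (by norm_num; linarith),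
      linkPiece_vertical J 1 (i + 1) (Or.inl (by linarith))]
    ext m
    fin_cases i <;> fin_cases m <;> simp [scaled, figureVertices, vertices] <;> ring

theorem decomposes_figureKnot (J : StringLink) : Decomposes J (figureKnot J) (1 : ℤ) figureArc := by
  rw [figureKnot_eq_assemble, figureArc_eq, Int.cast_one]
  exact (fits_figureArc J).decomposes fun i => contDiff_polyPath _ _

theorem tracks_figureArc (i : Fin 4) : Tracks (figureArc i) (figurePieces i) :=
  tracks_polyPath_subdivide _

/-! ### The standard position -/

/-- A smooth monotone function that is `0` for `x ≤ -5/4` and `1` for `5/4 ≤ x`. -/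
def turn (x : ℝ) : ℝ := (ramp (x + 1) - ramp (x - 1)) / 2

theorem turn_of_le {x : ℝ} (hx : x ≤ -(5 / 4)) : turn x = 0 := by
  rw [turn, ramp_of_le (by linarith), ramp_of_le (by linarith)]; norm_num

theorem turn_neg (x : ℝ) : turn (-x) = 1 - turn x := by
  have h1 := ramp_neg (x + 1)
  have h2 := ramp_neg (x - 1)
  rw [turn, turn, show -x + 1 = -(x - 1) by ring, show -x - 1 = -(x + 1) by ring, h1, h2]
  ring

theorem turn_of_ge {x : ℝ} (hx : 5 / 4 ≤ x) : turn x = 1 := by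
  have h := turn_neg x
  rw [turn_of_le (by linarith)] at h
  linarith

theorem contDiff_turn : ContDiff ℝ ∞ turn := by
  have h1 : ContDiff ℝ ∞ fun x : ℝ => ramp (x + 1) := contDiff_ramp.comp (by fun_prop)
  have h2 : ContDiff ℝ ∞ fun x : ℝ => ramp (x - 1) := contDiff_ramp.comp (by fun_prop)
  exact (h1.sub h2).div_const 2

theorem exists_hasDerivAt_turn (x : ℝ) : ∃ d, |d| ≤ 1 / 2 ∧ HasDerivAt turn d x := by
  have h1 := (hasDerivAt_ramp (x + 1)).comp x ((hasDerivAt_id x).add_const 1)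
  have h2 := (hasDerivAt_ramp (x - 1)).comp x ((hasDerivAt_id x).sub_const 1)
  refine ⟨_, ?_, (h1.sub h2).div_const 2⟩
  have a0 := Real.smoothTransition.nonneg (2 * (x + 1) + 1 / 2)
  have a1 := Real.smoothTransition.le_one (2 * (x + 1) + 1 / 2)
  have b0 := Real.smoothTransition.nonneg (2 * (x - 1) + 1 / 2)
  have b1 := Real.smoothTransition.le_one (2 * (x - 1) + 1 / 2)
  exact abs_le.2 ⟨by linarith, by linarith⟩

/-- The thresholds ±1/3 correspond to rotation angles π/3 and 2π/3, where the cosine is ±1/2. -/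
theorem turn_left {x : ℝ} (hx : x ≤ -(1 / 3)) : 0 ≤ turn x ∧ turn x ≤ 1 / 3 := by
  rw [turn, ramp_of_le (s := x - 1) (by linarith)]
  have h0 := ramp_nonneg (x + 1)
  have h1 := monotone_ramp (show x + 1 ≤ 2 / 3 by linarith)
  rw [ramp_of_ge (s := 2 / 3) (by norm_num)] at h1
  exact ⟨by linarith, by linarith⟩

theorem turn_right {x : ℝ} (hx : 1 / 3 ≤ x) : 2 / 3 ≤ turn x ∧ turn x ≤ 1 := by
  have h := turn_left (x := -x) (by linarith)
  rw [turn_neg] at h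
  exact ⟨by linarith, by linarith⟩

theorem turn_middle {x : ℝ} (h0 : -(1 / 3) ≤ x) (h1 : x ≤ 1 / 3) : turn x = (x + 1) / 2 := by
  rw [turn, ramp_of_ge (by linarith), ramp_of_le (by linarith), sub_zero]

/-- The outer arc before it is twisted. -/
def outerPath (s : ℝ) : R3 := polyPath (fun k => scaled 12 (outerVertices k)) 9 (2 * s)

/-- The outer arc, twisted by half a turn about the line `y = 1/2`, `z = 0`. -/
def twistedArc (s : ℝ) : R3 :=
  !₂[outerPath s 0, 1 / 2 + (outerPath s 1 - 1 / 2) * Real.cos (Real.pi * turn (outerPath s 0)),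
    (outerPath s 1 - 1 / 2) * Real.sin (Real.pi * turn (outerPath s 0))]

/-- The middle arc, which runs along the axis of the twist. -/
def middleArc (s : ℝ) : R3 := polyPath (fun k => scaled 12 (middleVertices k)) 9 (2 * s)

/-- The lower arc, which leaves the strands along the axis of the twist. -/
def lowerArc (s : ℝ) : R3 := polyPath (fun k => scaled 12 (lowerVertices k)) 9 (2 * s)

/-- The arcs of the knot in standard position. -/
def standardArc (i : Fin 4) : ℝ → R3 :=
  match i with
  | 0 => twistedArc
  | 1 => middleArc
  | 2 => fun s => flipMap (twistedArc (5 - s))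
  | 3 => lowerArc

theorem contDiff_outerPath : ContDiff ℝ ∞ outerPath :=
  (contDiff_polyPath _ 9).comp (contDiff_const.mul contDiff_id)

theorem contDiff_twistedArc : ContDiff ℝ ∞ twistedArc := by
  have h0 : ContDiff ℝ ∞ fun s => outerPath s 0 := (contDiff_coord 0).comp contDiff_outerPath
  have h1 : ContDiff ℝ ∞ fun s => outerPath s 1 - 1 / 2 :=
    ((contDiff_coord 1).comp contDiff_outerPath).sub contDiff_const
  have hθ : ContDiff ℝ ∞ fun s => Real.pi * turn (outerPath s 0) :=
    contDiff_const.mul (contDiff_turn.comp h0)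
  exact contDiff_toR3 h0 (contDiff_const.add (h1.mul (Real.contDiff_cos.comp hθ)))
    (h1.mul (Real.contDiff_sin.comp hθ))

theorem contDiff_standardArc (i : Fin 4) : ContDiff ℝ ∞ (standardArc i) := by
  fin_cases i
  · exact contDiff_twistedArc
  · exact (contDiff_polyPath _ 9).comp (contDiff_const.mul contDiff_id)
  · exact contDiff_flipMap.comp (contDiff_twistedArc.comp (contDiff_const.sub contDiff_id))
  · exact (contDiff_polyPath _ 9).comp (contDiff_const.mul contDiff_id)

theorem polyPath_coord_two {v : ℕ → R3} (hv : ∀ k, v k 2 = 0) (n : ℕ) (s : ℝ) :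
    polyPath v n s 2 = 0 := by
  induction n with
  | zero => simp [polyPath, hv]
  | succ n ih => simp [polyPath, hv, ih]

theorem vertices_snd_snd {l : List IntVec} (hl : ∀ p ∈ l, p.2.2 = 0) (k : ℕ) :
    (vertices l k).2.2 = 0 := by
  unfold vertices
  rw [List.getD_eq_getElem?_getD]
  rcases h : l[k]? with _ | p
  · rfl
  · exact hl p (List.mem_of_getElem? h)

theorem outerPath_two (s : ℝ) : outerPath s 2 = 0 :=
  polyPath_coord_two (fun k => by
    have h : (outerVertices k).2.2 = 0 := vertices_snd_snd (by decide) k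
    simp [scaled, h]) _ _

theorem middleArc_two (s : ℝ) : middleArc s 2 = 0 :=
  polyPath_coord_two (fun k => by
    have h : (middleVertices k).2.2 = 0 := vertices_snd_snd (by decide) k
    simp [scaled, h]) _ _

theorem lowerArc_two (s : ℝ) : lowerArc s 2 = 0 :=
  polyPath_coord_two (fun k => by
    have h : (lowerVertices k).2.2 = 0 := vertices_snd_snd (by decide) k
    simp [scaled, h]) _ _

/-- The half turn about the line `y = 1/2`, `z = 0`. -/
def halfTurn (p : R3) : R3 := !₂[p 0, 1 - p 1, -p 2]

theorem halfTurn_polyPath (v : ℕ → R3) (n : ℕ) (s : ℝ) :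
    halfTurn (polyPath v n s) = polyPath (fun k => halfTurn (v k)) n s := by
  induction n with
  | zero => ext m; fin_cases m <;> simp [polyPath, halfTurn] <;> ring
  | succ n ih =>
    rw [polyPath, polyPath, ← ih]
    ext m; fin_cases m <;> simp [halfTurn] <;> ring

theorem halfTurn_scaled (p : IntVec) : halfTurn (scaled 12 p) = scaled 12 (halfTurnVec p) := by
  ext m; fin_cases m <;> simp [halfTurn, scaled, halfTurnVec] <;> ring

theorem twistedArc_of_le {s : ℝ} (h : outerPath s 0 ≤ -(5 / 4)) : twistedArc s = outerPath s := by
  ext m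
  fin_cases m <;> simp [twistedArc, turn_of_le h, outerPath_two]

theorem twistedArc_of_ge {s : ℝ} (h : 5 / 4 ≤ outerPath s 0) :
    twistedArc s = polyPath (fun k => scaled 12 (halfTurnVec (outerVertices k))) 9 (2 * s) := by
  have e : (fun k => scaled 12 (halfTurnVec (outerVertices k))) =
      fun k => halfTurn (scaled 12 (outerVertices k)) := by funext k; rw [halfTurn_scaled]
  rw [e, ← halfTurn_polyPath]
  change _ = halfTurn (outerPath s)
  ext m
  fin_cases m <;> simp [twistedArc, turn_of_ge h, outerPath_two, halfTurn]; ring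

theorem tracks_outerPath : Tracks outerPath (polygonPieces outerVertices) := tracks_polyPath _

theorem InHull.coord_zero {H : List IntVec} {p : R3} (h : InHull H p) {l u : ℤ}
    (hl : ∀ q ∈ H, l ≤ q.1) (hu : ∀ q ∈ H, q.1 ≤ u) : (l : ℝ) ≤ 24 * p 0 ∧ 24 * p 0 ≤ u := by
  have h1 := h (1, 0, 0) l (by simpa [intDot] using hl)
  have h2 := h (-1, 0, 0) (-u) (by simpa [intDot] using hu)
  simp [pairing_apply] at h1 h2
  exact ⟨h1, by linarith⟩

theorem InHull.coord_one {H : List IntVec} {p : R3} (h : InHull H p) {l u : ℤ}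
    (hl : ∀ q ∈ H, l ≤ q.2.1) (hu : ∀ q ∈ H, q.2.1 ≤ u) : (l : ℝ) ≤ 24 * p 1 ∧ 24 * p 1 ≤ u := by
  have h1 := h (0, 1, 0) l (by simpa [intDot] using hl)
  have h2 := h (0, -1, 0) (-u) (by simpa [intDot] using hu)
  simp [pairing_apply] at h1 h2
  exact ⟨h1, by linarith⟩

theorem coord_hasDerivAt {f : ℝ → R3} {d : R3} {s : ℝ} (h : HasDerivAt f d s) (m : Fin 3) :
    HasDerivAt (fun s => f s m) (d m) s :=
  (EuclideanSpace.proj m : R3 →L[ℝ] ℝ).hasFDerivAt.comp_hasDerivAt s h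

/-- Positivity on the four edges means that the first coefficient exceeds ten times the sum of the
absolute values of the other two. -/
theorem inCone_twistVel {v : R3} (h0 : 0 < v 0) (h1 : |v 1| ≤ 10 * v 0) (h2 : |v 2| ≤ 10 * v 0) :
    InCone twistVel v := by
  intro c hc
  simp only [twistVel, List.mem_cons, List.not_mem_nil, or_false, forall_eq_or_imp, forall_eq,
    intDot] at hc
  obtain ⟨c1, c2, c3, c4⟩ := hc
  have c1 : (0 : ℝ) < c.1 + 10 * c.2.1 + 10 * c.2.2 := by exact_mod_cast (by linarith)
  have c2 : (0 : ℝ) < c.1 + 10 * c.2.1 - 10 * c.2.2 := by exact_mod_cast (by linarith)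
  have c3 : (0 : ℝ) < c.1 - 10 * c.2.1 + 10 * c.2.2 := by exact_mod_cast (by linarith)
  have c4 : (0 : ℝ) < c.1 - 10 * c.2.1 - 10 * c.2.2 := by exact_mod_cast (by linarith)
  rw [pairing_apply]
  have key : ∀ x y : ℝ, |y| ≤ 10 * v 0 → -(10 * |x|) * v 0 ≤ x * y := fun x y hy => by
    have h3 := neg_abs_le (x * y)
    rw [abs_mul] at h3
    nlinarith [mul_le_mul_of_nonneg_left hy (abs_nonneg x)]
  have k1 := key c.2.1 _ h1
  have k2 := key c.2.2 _ h2
  have h3 : 0 < c.1 - 10 * |(c.2.1 : ℝ)| - 10 * |(c.2.2 : ℝ)| := by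
    rcases abs_cases (c.2.1 : ℝ) with h | h <;> rcases abs_cases (c.2.2 : ℝ) with h' | h' <;>
      linarith
  nlinarith [mul_pos h3 h0]

theorem outerPath_deriv_one {k : Fin 11} (h4 : 4 ≤ k) (h6 : k ≤ 6) {s : ℝ}
    (hk : |2 * s - (k : ℕ)| ≤ 1 / 2) : deriv outerPath s 1 = 0 := by
  have h2 : HasDerivAt (fun s : ℝ => 2 * s) 2 s := by simpa using (hasDerivAt_id s).const_mul 2
  have hd : deriv outerPath s = (2 : ℝ) • polyVel (fun k => scaled 12 (outerVertices k)) 9 (2 * s) :=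
    ((hasDerivAt_polyPath _ _ _).scomp s h2).deriv
  obtain ⟨j, hj3, hj5, hj⟩ : ∃ j : ℕ, 3 ≤ j ∧ j ≤ 5 ∧ (k : ℕ) = j + 1 :=
    ⟨k - 1, by have : 4 ≤ (k : ℕ) := h4; omega, by have : (k : ℕ) ≤ 6 := h6; omega,
      by have : 4 ≤ (k : ℕ) := h4; omega⟩
  rw [hj] at hk
  obtain ⟨σ, -, hσ⟩ := polyVel_corner (fun k => scaled 12 (outerVertices k))
    (show j < 9 by omega) (hk.trans (by norm_num))
  rw [hd, hσ]
  interval_cases j <;> simp [scaled, outerVertices, vertices]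

/-- For |x| ≥ 5/4 the twist is the identity or a half turn, so the polygon bounds carry over. In the
three middle windows the untwisted arc has height 3, so the twisted one lies on the cylinder of
radius 5/2 about the axis, and bounds on the angle give the boxes. -/
theorem tracks_twistedArc : Tracks twistedArc twistedPieces := by
  have hleft : ∀ k : Fin 11, k < 4 → ∀ q ∈ (polygonPieces outerVertices k).hull,
      -108 ≤ q.1 ∧ q.1 ≤ -32 := by decide
  have hright : ∀ k : Fin 11, 6 < k → ∀ q ∈ (polygonPieces outerVertices k).hull,
      32 ≤ q.1 ∧ q.1 ≤ 84 := by decide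
  have hy : ∀ k : Fin 11, 4 ≤ k → k ≤ 6 → ∀ q ∈ (polygonPieces outerVertices k).hull,
      72 ≤ q.2.1 ∧ q.2.1 ≤ 72 := by decide
  have hcont : Continuous fun s => outerPath s 0 :=
    ((contDiff_coord 0).comp contDiff_outerPath).continuous
  have left : ∀ k : Fin 11, k < 4 → ∀ s ∈ Set.Icc (0 : ℝ) 5, |2 * s - (k : ℕ)| ≤ 1 / 2 →
      outerPath s 0 < -(5 / 4) := fun k h s hs hk => by
    have := ((tracks_outerPath.pos k s hs hk).coord_zero (fun q hq => (hleft k h q hq).1)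
      fun q hq => (hleft k h q hq).2).2
    norm_num at this
    linarith
  have right : ∀ k : Fin 11, 6 < k → ∀ s ∈ Set.Icc (0 : ℝ) 5, |2 * s - (k : ℕ)| ≤ 1 / 2 →
      5 / 4 < outerPath s 0 := fun k h s hs hk => by
    have := ((tracks_outerPath.pos k s hs hk).coord_zero (fun q hq => (hright k h q hq).1)
      fun q hq => (hright k h q hq).2).1
    norm_num at this
    linarith
  have height : ∀ k : Fin 11, 4 ≤ k → k ≤ 6 → ∀ s ∈ Set.Icc (0 : ℝ) 5,
      |2 * s - (k : ℕ)| ≤ 1 / 2 → outerPath s 1 = 3 := fun k h h' s hs hk => by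
    have := (tracks_outerPath.pos k s hs hk).coord_one (fun q hq => (hy k h h' q hq).1)
      fun q hq => (hy k h h' q hq).2
    norm_num at this
    linarith [this.1, this.2]
  have hpi := Real.pi_pos
  have hsin1 := fun x => Real.sin_le_one x
  have hcos1 := fun x => Real.cos_le_one x
  have hcos1' := fun x => Real.neg_one_le_cos x
  constructor
  · intro k s hs hk
    by_cases h4 : k < 4
    · rw [twistedPieces, if_pos h4, twistedArc_of_le (left k h4 s hs hk).le]
      exact tracks_outerPath.pos k s hs hk
    by_cases h6 : 6 < k
    · rw [twistedPieces, if_neg h4, if_neg (by omega), if_neg (by omega), if_neg (by omega),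
        twistedArc_of_ge (right k h6 s hs hk).le]
      exact (tracks_polyPath _).pos k s hs hk
    have hyk := height k (by omega) (by omega) s hs hk
    have hP := tracks_outerPath.pos k s hs hk
    obtain rfl | rfl | rfl : k = 4 ∨ k = 5 ∨ k = 6 := by omega
    · have hx := hP.coord_zero (l := -32) (u := -8) (by decide) (by decide)
      push_cast at hx
      obtain ⟨t0, t1⟩ := turn_left (x := outerPath s 0) (by linarith [hx.2])
      set θ := Real.pi * turn (outerPath s 0)
      have hs0 : 0 ≤ Real.sin θ := Real.sin_nonneg_of_nonneg_of_le_pi (by positivity) (by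
        simp only [θ]; nlinarith)
      have hc : 1 / 2 ≤ Real.cos θ := by
        rw [← Real.cos_pi_div_three]
        exact Real.cos_le_cos_of_nonneg_of_le_pi (by positivity) (by linarith) (by
          simp only [θ]; nlinarith)
      apply inHull_boxHull <;> simp [twistedArc, hyk] <;> linarith [hsin1 θ, hcos1 θ, hx.1, hx.2]
    · have hx := hP.coord_zero (l := -8) (u := 8) (by decide) (by decide)
      push_cast at hx
      have ht := turn_middle (x := outerPath s 0) (by linarith [hx.1]) (by linarith [hx.2])
      have t0 : 1 / 3 ≤ turn (outerPath s 0) := by rw [ht]; linarith [hx.1]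
      have t1 : turn (outerPath s 0) ≤ 2 / 3 := by rw [ht]; linarith [hx.2]
      set θ := Real.pi * turn (outerPath s 0)
      have hs0 : 0 ≤ Real.sin θ := Real.sin_nonneg_of_nonneg_of_le_pi (by positivity) (by
        simp only [θ]; nlinarith)
      have hc : Real.cos θ ≤ 1 / 2 := by
        rw [← Real.cos_pi_div_three]
        exact Real.cos_le_cos_of_nonneg_of_le_pi (by positivity) (by simp only [θ]; nlinarith) (by
          simp only [θ]; nlinarith)
      have hc' : -(1 / 2) ≤ Real.cos θ := by
        have : Real.cos (Real.pi - θ) ≤ 1 / 2 := by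
          rw [← Real.cos_pi_div_three]
          exact Real.cos_le_cos_of_nonneg_of_le_pi (by positivity) (by simp only [θ]; nlinarith) (by
            simp only [θ]; nlinarith)
        rw [Real.cos_pi_sub] at this
        linarith
      -- Here sin² θ ≥ 3/4 > 16/25, which keeps the arc at z ≥ 2, well in front of the axis.
      have hs1 : 4 / 5 ≤ Real.sin θ := by
        have := Real.sin_sq_add_cos_sq θ
        nlinarith
      apply inHull_boxHull <;> simp [twistedArc, hyk] <;> linarith [hsin1 θ, hcos1 θ, hx.1, hx.2]
    · have hx := hP.coord_zero (l := 8) (u := 32) (by decide) (by decide)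
      push_cast at hx
      obtain ⟨t0, t1⟩ := turn_right (x := outerPath s 0) (by linarith [hx.1])
      set θ := Real.pi * turn (outerPath s 0)
      have hs0 : 0 ≤ Real.sin θ := Real.sin_nonneg_of_nonneg_of_le_pi (by positivity) (by
        simp only [θ]; nlinarith)
      have hc : Real.cos θ ≤ -(1 / 2) := by
        have : 1 / 2 ≤ Real.cos (Real.pi - θ) := by
          rw [← Real.cos_pi_div_three]
          exact Real.cos_le_cos_of_nonneg_of_le_pi (by simp only [θ]; nlinarith) (by linarith) (by
            simp only [θ]; nlinarith)
        rw [Real.cos_pi_sub] at this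
        linarith
      apply inHull_boxHull <;> simp [twistedArc, hyk] <;> linarith [hsin1 θ, hcos1' θ, hx.1, hx.2]
  · intro k s hs hk
    by_cases h4 : k < 4
    · have he : twistedArc =ᶠ[nhds s] outerPath := by
        filter_upwards [hcont.continuousAt.eventually (Iio_mem_nhds (left k h4 s hs hk))] with s' hs'
        exact twistedArc_of_le (le_of_lt hs')
      rw [twistedPieces, if_pos h4, he.deriv_eq]
      exact tracks_outerPath.vel k s hs hk
    by_cases h6 : 6 < k
    · have he : twistedArc =ᶠ[nhds s]
          fun s => polyPath (fun k => scaled 12 (halfTurnVec (outerVertices k))) 9 (2 * s) := by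
        filter_upwards [hcont.continuousAt.eventually (Ioi_mem_nhds (right k h6 s hs hk))] with s' hs'
        exact twistedArc_of_ge (le_of_lt hs')
      rw [twistedPieces, if_neg h4, if_neg (by omega), if_neg (by omega), if_neg (by omega),
        he.deriv_eq]
      exact (tracks_polyPath _).vel k s hs hk
    have hyk := height k (by omega) (by omega) s hs hk
    have hd1 := outerPath_deriv_one (k := k) (by omega) (by omega) hk
    have hvel : (twistedPieces k).vel = twistVel := by
      obtain rfl | rfl | rfl : k = 4 ∨ k = 5 ∨ k = 6 := by omega
      all_goals rfl
    have hd0 : 0 < deriv outerPath s 0 := by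
      have := tracks_outerPath.vel k s hs hk (1, 0, 0) (by
        obtain rfl | rfl | rfl : k = 4 ∨ k = 5 ∨ k = 6 := by omega
        all_goals decide)
      simpa [pairing_apply] using this
    rw [hvel]
    have hO := (contDiff_outerPath.differentiable (by simp) s).hasDerivAt
    have hT := (contDiff_twistedArc.differentiable (by simp) s).hasDerivAt
    have hx := coord_hasDerivAt hO 0
    have hy := coord_hasDerivAt hO 1
    rw [hd1] at hy
    obtain ⟨e, he, hturn⟩ := exists_hasDerivAt_turn (outerPath s 0)
    have hθ := (hturn.comp s hx).const_mul Real.pi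
    have v0 : deriv twistedArc s 0 = deriv outerPath s 0 := (coord_hasDerivAt hT 0).unique hx
    have v1 := (coord_hasDerivAt hT 1).unique (((hy.sub_const (1 / 2)).mul hθ.cos).const_add (1 / 2))
    have v2 := (coord_hasDerivAt hT 2).unique ((hy.sub_const (1 / 2)).mul hθ.sin)
    simp only [Function.comp_apply, zero_mul, zero_add, hyk] at v1 v2
    have hpi4 := Real.pi_le_four
    -- With radius 5/2, slope of `turn` at most 1/2 and π ≤ 4, the factor is at most 5; the cone
    -- allows 10.
    have bound : ∀ x : ℝ, |x| ≤ 1 → |(3 - 1 / 2) * (x * (Real.pi * (e * deriv outerPath s 0)))| ≤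
        10 * deriv outerPath s 0 := fun x hx => by
      rw [abs_mul, abs_mul, abs_mul, abs_mul, abs_of_pos hd0, abs_of_pos hpi]
      norm_num
      have h1 : |e| * |x| ≤ 1 / 2 := by nlinarith [abs_nonneg e, abs_nonneg x]
      have h2 : Real.pi * (|e| * |x|) ≤ 2 := by nlinarith [abs_nonneg e, abs_nonneg x]
      nlinarith
    refine inCone_twistVel (by rw [v0]; exact hd0) ?_ ?_
    · rw [v1, v0]
      exact bound _ (by rw [abs_neg]; exact Real.abs_sin_le_one _)
    · rw [v2, v0]
      exact bound _ (Real.abs_cos_le_one _)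


/-! ### The knot in standard position -/

theorem pairing_flipMap (c : IntVec) (p : R3) : pairing c (flipMap p) = pairing (flipVec c) p := by
  simp [pairing_apply, flipMap, flipVec]

theorem intDot_flipVec (c p : IntVec) : intDot c (flipVec p) = intDot (flipVec c) p := by
  simp [intDot, flipVec]

/-- The flip is self-adjoint, so functionals are pulled back by `flipVec`; reversing time exchanges
window k with 10 - k and negates velocities. -/
theorem Tracks.flip_reverse {a : ℝ → R3} {P : Fin 11 → Piece} (h : Tracks a P)
    (ha : ContDiff ℝ ∞ a) :
    Tracks (fun s => flipMap (a (5 - s))) (fun k => flipPiece (P k.rev)) := by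
  have mem : ∀ s ∈ Set.Icc (0 : ℝ) 5, 5 - s ∈ Set.Icc (0 : ℝ) 5 := fun s hs =>
    ⟨by linarith [hs.2], by linarith [hs.1]⟩
  have time : ∀ (k : Fin 11) (s : ℝ), |2 * s - (k : ℕ)| ≤ 1 / 2 →
      |2 * (5 - s) - (k.rev : ℕ)| ≤ 1 / 2 := fun k s hk => by
    have hr : ((k.rev : ℕ) : ℝ) = 10 - (k : ℕ) := by
      have h1 : (k.rev : ℕ) + (k : ℕ) = 10 := by rw [Fin.val_rev]; omega
      rw [eq_sub_iff_add_eq]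
      exact_mod_cast h1
    rw [hr, show 2 * (5 - s) - (10 - ((k : ℕ) : ℝ)) = -(2 * s - (k : ℕ)) by ring, abs_neg]
    exact hk
  constructor
  · intro k s hs hk c m hm
    rw [pairing_flipMap]
    refine h.pos k.rev (5 - s) (mem s hs) (time k s hk) _ _ fun q hq => ?_
    rw [← intDot_flipVec]
    exact hm _ (List.mem_map_of_mem hq)
  · intro k s hs hk c hc
    have h1 := h.vel k.rev (5 - s) (mem s hs) (time k s hk) (-flipVec c) fun q hq => by
      have := hc _ (List.mem_map_of_mem hq)
      rw [intDot_neg, ← intDot_flipVec]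
      simp only [intDot, Prod.fst_neg, Prod.snd_neg] at this ⊢
      linarith
    rw [pairing_neg] at h1
    have hd : Differentiable ℝ fun s => flipMap (a (5 - s)) :=
      (contDiff_flipMap.comp (ha.comp (contDiff_const.sub contDiff_id))).differentiable (by simp)
    have e1 := (pairing c).hasFDerivAt.comp_hasDerivAt s (hd s).hasDerivAt
    have e2 : HasDerivAt (fun s : ℝ => 5 - s) (-1) s := by
      simpa using (hasDerivAt_id s).const_sub 5
    have e3 := (ha.differentiable (by simp) (5 - s)).hasDerivAt.scomp s e2
    have e4 := (pairing (flipVec c)).hasFDerivAt.comp_hasDerivAt s e3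
    have e5 := e1.unique (e4.congr_of_eventuallyEq
      (Filter.Eventually.of_forall fun s => pairing_flipMap c _))
    rw [e5, map_smul, smul_eq_mul]
    linarith

theorem tracks_standardArc (i : Fin 4) : Tracks (standardArc i) (standardPieces i) := by
  fin_cases i
  · exact tracks_twistedArc
  · exact tracks_polyPath _
  · exact tracks_twistedArc.flip_reverse contDiff_twistedArc
  · exact tracks_polyPath _

theorem twistedArc_start {s : ℝ} (h : s ≤ 1 / 4) : twistedArc s = !₂[-(9 / 2), 1 + s, 0] := by
  have e : outerPath s = !₂[-(9 / 2), 1 + s, 0] := by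
    rw [outerPath, polyPath_start _ _ (by linarith)]
    ext m
    fin_cases m <;> simp [scaled, outerVertices, vertices] <;> ring
  rw [twistedArc_of_le, e]
  rw [e]; simp; norm_num

theorem twistedArc_finish {s : ℝ} (h : 19 / 4 ≤ s) : twistedArc s = !₂[7 / 2, s - 5, 0] := by
  have e : outerPath s 0 = 7 / 2 := by
    rw [outerPath, polyPath_of_ge _ _ (by norm_num; linarith)]
    simp [scaled, outerVertices, vertices]; norm_num
  rw [twistedArc_of_ge (by rw [e]; norm_num), polyPath_of_ge _ _ (by norm_num; linarith)]
  ext m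
  fin_cases m <;> simp [scaled, outerVertices, vertices, halfTurnVec] <;> ring

theorem fits_standardArc (J : StringLink) : Fits J 0 standardArc where
  start i s h0 h1 := by
    rw [linkPiece_vertical J 0 i (Or.inr (by linarith))]
    fin_cases i
    · simp only [standardArc, twistedArc_start h1]
    · simp only [standardArc, middleArc]
      rw [polyPath_start _ _ (by linarith)]
      ext m
      fin_cases m <;> simp [scaled, middleVertices, vertices] <;> ring
    · simp only [standardArc]
      rw [twistedArc_finish (by linarith)]
      ext m
      fin_cases m <;> simp [flipMap]
    · simp only [standardArc, lowerArc]
      rw [polyPath_start _ _ (by linarith)]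
      ext m
      fin_cases m <;> simp [scaled, lowerVertices, vertices] <;> ring
  finish i s h0 h1 := by
    rw [linkPiece_vertical J 0 (i + 1) (Or.inl (by linarith))]
    fin_cases i
    · simp [standardArc, twistedArc_finish h0]
    · simp only [standardArc, middleArc]
      rw [polyPath_of_ge _ _ (by norm_num; linarith)]
      ext m
      fin_cases m <;> simp [scaled, middleVertices, vertices] <;> ring
    · simp only [standardArc]
      rw [twistedArc_start (by linarith)]
      ext m
      fin_cases m <;> simp [flipMap]; ring
    · simp only [standardArc, lowerArc]
      rw [polyPath_of_ge _ _ (by norm_num; linarith)]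
      ext m
      fin_cases m <;> simp [scaled, lowerVertices, vertices] <;> ring

/-- The knot in standard position. -/
def standardKnot (J : StringLink) : ℝ → R3 := assemble J 0 standardArc

theorem decomposes_standardKnot (J : StringLink) :
    Decomposes J (standardKnot J) (0 : ℤ) standardArc := by
  rw [Int.cast_zero]
  exact (fits_standardArc J).decomposes contDiff_standardArc

/-- The knot is the start of the certified straight-line homotopy; `standardKnot J` is its end. -/
theorem isKnot_figureKnot (J : StringLink) : IsKnot (figureKnot J) := by
  simpa using certifies_standard.isKnot (decomposes_figureKnot J) (decomposes_standardKnot J)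
    tracks_figureArc tracks_standardArc (t := 0) (by simp)

theorem isKnot_standardKnot (J : StringLink) : IsKnot (standardKnot J) := by
  simpa using certifies_standard.isKnot (decomposes_figureKnot J) (decomposes_standardKnot J)
    tracks_figureArc tracks_standardArc (t := 1) (by simp)

theorem isotopic_standardKnot (J : StringLink) : Isotopic (figureKnot J) (standardKnot J) :=
  certifies_standard.isotopic (decomposes_figureKnot J) (decomposes_standardKnot J)
    tracks_figureArc tracks_standardArc


/-! ### Untwisting the standard position -/

/-- The rotation by the angle `θ` about the line `y = 1/2`, `z = 0`. -/
def axisRotate (θ : ℝ) (p : R3) : R3 :=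
  !₂[p 0, 1 / 2 + ((p 1 - 1 / 2) * Real.cos θ - p 2 * Real.sin θ),
    (p 1 - 1 / 2) * Real.sin θ + p 2 * Real.cos θ]

/-- The square of the distance from the line `y = 1/2`, `z = 0`. -/
def axisDistSq (p : R3) : ℝ := (p 1 - 1 / 2) ^ 2 + p 2 ^ 2

/-- The angle by which the untwisting map rotates the point `p` in total. -/
def untwistAngle (p : R3) : ℝ :=
  2 * Real.pi * (1 - turn (p 0)) * Real.smoothTransition (2 * p 0 + 14) *
    Real.smoothTransition ((16 - axisDistSq p) / 7)

/-- The isotopy that undoes a full twist about the line `y = 1/2`, `z = 0`. -/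
def untwist (t : ℝ) (p : R3) : R3 := axisRotate (t * untwistAngle p) p

theorem axisDistSq_axisRotate (θ : ℝ) (p : R3) : axisDistSq (axisRotate θ p) = axisDistSq p := by
  simp only [axisDistSq, axisRotate]
  simp
  linear_combination ((p 1 - 1 / 2) ^ 2 + p 2 ^ 2) * Real.sin_sq_add_cos_sq θ

/-- The angle depends only on x and the distance from the axis, which the rotation preserves. Hence
each `untwist t` has inverse `untwist (-t)`. -/
theorem untwistAngle_axisRotate (θ : ℝ) (p : R3) :
    untwistAngle (axisRotate θ p) = untwistAngle p := by
  rw [untwistAngle, axisDistSq_axisRotate]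
  simp [axisRotate, untwistAngle]

theorem axisRotate_neg (θ : ℝ) (p : R3) : axisRotate (-θ) (axisRotate θ p) = p := by
  have h := Real.sin_sq_add_cos_sq θ
  ext m
  fin_cases m <;> simp [axisRotate]
  · linear_combination (p 1 - 1 / 2) * h
  · linear_combination (p 2) * h

theorem axisRotate_zero (p : R3) : axisRotate 0 p = p := by
  ext m; fin_cases m <;> simp [axisRotate]

theorem axisRotate_two_pi (p : R3) : axisRotate (2 * Real.pi) p = p := by
  ext m; fin_cases m <;> simp [axisRotate]

theorem untwist_neg (t : ℝ) (p : R3) : untwist (-t) (untwist t p) = p := by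
  rw [untwist, untwist, untwistAngle_axisRotate, neg_mul, axisRotate_neg]

theorem contDiff_untwist : ContDiff ℝ ∞ fun q : ℝ × R3 => untwist q.1 q.2 := by
  have c : ∀ i, ContDiff ℝ ∞ fun q : ℝ × R3 => q.2 i := fun i => (contDiff_coord i).comp contDiff_snd
  have hr : ContDiff ℝ ∞ fun q : ℝ × R3 => axisDistSq q.2 :=
    (((c 1).sub contDiff_const).pow 2).add ((c 2).pow 2)
  have hθ : ContDiff ℝ ∞ fun q : ℝ × R3 => q.1 * untwistAngle q.2 :=
    contDiff_fst.mul (((contDiff_const.mul (contDiff_const.sub (contDiff_turn.comp (c 0)))).mul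
      (Real.smoothTransition.contDiff.comp ((contDiff_const.mul (c 0)).add contDiff_const))).mul
      (Real.smoothTransition.contDiff.comp ((contDiff_const.sub hr).div_const 7)))
  have hc := Real.contDiff_cos.comp hθ
  have hs := Real.contDiff_sin.comp hθ
  have hy : ContDiff ℝ ∞ fun q : ℝ × R3 => q.2 1 - 1 / 2 := (c 1).sub contDiff_const
  exact contDiff_toR3 (c 0) (contDiff_const.add ((hy.mul hc).sub ((c 2).mul hs)))
    ((hy.mul hs).add ((c 2).mul hc))

theorem untwist_of_turn {p : R3} (h : 5 / 4 ≤ p 0) : untwist 1 p = p := by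
  rw [untwist, untwistAngle, turn_of_ge h]; simp [axisRotate_zero]

theorem untwist_of_le {p : R3} (h : p 0 ≤ -7) : untwist 1 p = p := by
  rw [untwist, untwistAngle, Real.smoothTransition.zero_of_nonpos (x := 2 * p 0 + 14) (by linarith)]
  simp [axisRotate_zero]

theorem untwist_of_far {p : R3} (h : 16 ≤ axisDistSq p) : untwist 1 p = p := by
  rw [untwist, untwistAngle,
    Real.smoothTransition.zero_of_nonpos (x := (16 - axisDistSq p) / 7) (by linarith)]
  simp [axisRotate_zero]

theorem untwist_of_axis {p : R3} (h1 : p 1 = 1 / 2) (h2 : p 2 = 0) : untwist 1 p = p := by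
  ext m; fin_cases m <;> simp [untwist, axisRotate, h1, h2]

theorem untwist_of_near {p : R3} (h0 : -(13 / 2) ≤ p 0) (hr : axisDistSq p ≤ 9) :
    untwist 1 p = axisRotate (2 * Real.pi * (1 - turn (p 0))) p := by
  rw [untwist, untwistAngle, Real.smoothTransition.one_of_one_le (by linarith),
    Real.smoothTransition.one_of_one_le (by linarith)]
  simp

theorem untwist_of_left {p : R3} (h0 : -(13 / 2) ≤ p 0) (h0' : p 0 ≤ -(5 / 4))
    (hr : axisDistSq p ≤ 9) : untwist 1 p = p := by
  rw [untwist_of_near h0 hr, turn_of_le h0', sub_zero, mul_one, axisRotate_two_pi]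

/-- The left box is rotated rigidly through 2π and the right box not at all. -/
theorem untwist_linkPiece (J : StringLink) (i : Fin 4) {τ : ℝ} (hτ : τ ∈ Set.Icc (0 : ℝ) 1) :
    untwist 1 (linkPiece J 0 i τ) = linkPiece J 0 i τ := by
  rcases linkPiece_mem_box J 0 i hτ with ⟨⟨h1, h2⟩, ⟨h3, h4⟩, h5, h6⟩ | ⟨⟨h1, h2⟩, -⟩
  · exact untwist_of_left (by linarith) (by linarith) (by unfold axisDistSq; nlinarith)
  · exact untwist_of_turn (by linarith)

theorem outerPath_bounds {s : ℝ} (hs : s ∈ Set.Icc (0 : ℝ) 5) :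
    (-(9 / 2) ≤ outerPath s 0 ∧ outerPath s 0 ≤ 9 / 2) ∧ 1 ≤ outerPath s 1 ∧ outerPath s 1 ≤ 3 := by
  obtain ⟨k, hk⟩ := exists_piece hs
  have hb : ∀ k : Fin 11, ∀ q ∈ (polygonPieces outerVertices k).hull,
      (-108 ≤ q.1 ∧ q.1 ≤ 108) ∧ 24 ≤ q.2.1 ∧ q.2.1 ≤ 72 := by decide
  have hP := tracks_outerPath.pos k s hs hk
  have hx := hP.coord_zero (fun q hq => (hb k q hq).1.1) fun q hq => (hb k q hq).1.2
  have hy := hP.coord_one (fun q hq => (hb k q hq).2.1) fun q hq => (hb k q hq).2.2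
  norm_num at hx hy
  exact ⟨⟨by linarith [hx.1], by linarith [hx.2]⟩, by linarith [hy.1], by linarith [hy.2]⟩

theorem axisDistSq_twistedArc (s : ℝ) : axisDistSq (twistedArc s) = (outerPath s 1 - 1 / 2) ^ 2 := by
  simp only [axisDistSq, twistedArc]
  simp
  linear_combination (outerPath s 1 - 1 / 2) ^ 2 *
    Real.sin_sq_add_cos_sq (Real.pi * turn (outerPath s 0))

theorem axisDistSq_flipMap (p : R3) : axisDistSq (flipMap p) = axisDistSq p := by
  simp [axisDistSq, flipMap]

/-- At polar angle θ the added rotation is 2π - 2θ, so the new angle is -θ modulo 2π. -/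
theorem untwist_twistedArc {s : ℝ} (hs : s ∈ Set.Icc (0 : ℝ) 5) :
    untwist 1 (twistedArc s) = mirrorMap (twistedArc s) := by
  obtain ⟨⟨h0, -⟩, h1, h1'⟩ := outerPath_bounds hs
  have e : twistedArc s 0 = outerPath s 0 := rfl
  rw [untwist_of_near (by rw [e]; linarith) (by rw [axisDistSq_twistedArc]; nlinarith), e]
  set θ := Real.pi * turn (outerPath s 0) with hθ
  have ea : 2 * Real.pi * (1 - turn (outerPath s 0)) = 2 * Real.pi - 2 * θ := by rw [hθ]; ring
  have h := Real.sin_sq_add_cos_sq θ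
  rw [ea]
  ext m
  fin_cases m <;> simp [axisRotate, mirrorMap, twistedArc, ← hθ, Real.cos_two_pi_sub,
    Real.sin_two_pi_sub, Real.sin_two_mul, Real.cos_two_mul]
  · linear_combination 2 * (outerPath s 1 - 1 / 2) * Real.cos θ * h
  · ring

/-- The flipped point has polar angle -θ, and since `turn (-x)` = 1 - `turn x` the added rotation is
2θ. -/
theorem untwist_flip_twistedArc {s : ℝ} (hs : s ∈ Set.Icc (0 : ℝ) 5) :
    untwist 1 (flipMap (twistedArc s)) = mirrorMap (flipMap (twistedArc s)) := by
  obtain ⟨⟨-, h0⟩, h1, h1'⟩ := outerPath_bounds hs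
  have e : flipMap (twistedArc s) 0 = -outerPath s 0 := rfl
  rw [untwist_of_near (by rw [e]; linarith)
    (by rw [axisDistSq_flipMap, axisDistSq_twistedArc]; nlinarith), e, turn_neg]
  set θ := Real.pi * turn (outerPath s 0) with hθ
  have ea : 2 * Real.pi * (1 - (1 - turn (outerPath s 0))) = 2 * θ := by rw [hθ]; ring
  have h := Real.sin_sq_add_cos_sq θ
  rw [ea]
  ext m
  fin_cases m <;> simp [axisRotate, mirrorMap, flipMap, twistedArc, ← hθ,
    Real.sin_two_mul, Real.cos_two_mul]
  · linear_combination 2 * (outerPath s 1 - 1 / 2) * Real.cos θ * h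
  · ring

/-- Wherever the rotation angle is not a multiple of 2π, the arc lies on the axis. -/
theorem untwist_middleArc {s : ℝ} (hs : s ∈ Set.Icc (0 : ℝ) 5) :
    untwist 1 (middleArc s) = middleArc s := by
  obtain ⟨k, hk⟩ := exists_piece hs
  have hP : InHull (polygonPieces middleVertices k).hull (middleArc s) :=
    (tracks_polyPath middleVertices).pos k s hs hk
  have right : ∀ k : Fin 11, k < 4 → ∀ q ∈ (polygonPieces middleVertices k).hull,
      36 ≤ q.1 ∧ q.1 ≤ 84 := by decide
  have centre : ∀ k : Fin 11, 4 ≤ k → k < 7 → ∀ q ∈ (polygonPieces middleVertices k).hull,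
      12 ≤ q.2.1 ∧ q.2.1 ≤ 12 := by decide
  have left : ∀ k : Fin 11, 7 ≤ k → ∀ q ∈ (polygonPieces middleVertices k).hull,
      (-84 ≤ q.1 ∧ q.1 ≤ -36) ∧ 12 ≤ q.2.1 ∧ q.2.1 ≤ 36 := by decide
  rcases lt_or_ge k 4 with h4 | h4
  · have hx := hP.coord_zero (fun q hq => (right k h4 q hq).1) fun q hq => (right k h4 q hq).2
    norm_num at hx
    exact untwist_of_turn (by linarith [hx.1])
  rcases lt_or_ge k 7 with h7 | h7
  · have hy := hP.coord_one (fun q hq => (centre k h4 h7 q hq).1)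
      fun q hq => (centre k h4 h7 q hq).2
    norm_num at hy
    exact untwist_of_axis (by linarith [hy.1, hy.2]) (middleArc_two s)
  · have hx := hP.coord_zero (fun q hq => (left k h7 q hq).1.1) fun q hq => (left k h7 q hq).1.2
    have hy := hP.coord_one (fun q hq => (left k h7 q hq).2.1) fun q hq => (left k h7 q hq).2.2
    norm_num at hx hy
    refine untwist_of_left (by linarith [hx.1]) (by linarith [hx.2]) ?_
    rw [axisDistSq, middleArc_two]
    nlinarith [hy.1, hy.2]

/-- On the right the rotation is trivial, and the bottom lies beyond distance 4 from the axis. On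
the left the arc crosses the zone -7 ≤ x ≤ -13/2, where the rotation is faded out, along the axis.
-/
theorem untwist_lowerArc {s : ℝ} (hs : s ∈ Set.Icc (0 : ℝ) 5) :
    untwist 1 (lowerArc s) = lowerArc s := by
  obtain ⟨k, hk⟩ := exists_piece hs
  have hP : InHull (polygonPieces lowerVertices k).hull (lowerArc s) :=
    (tracks_polyPath lowerVertices).pos k s hs hk
  have right : ∀ k : Fin 11, k < 5 → ∀ q ∈ (polygonPieces lowerVertices k).hull,
      36 ≤ q.1 ∧ q.1 ≤ 192 := by decide
  have bottom : ∀ k : Fin 11, 5 ≤ k → k < 7 → ∀ q ∈ (polygonPieces lowerVertices k).hull,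
      -240 ≤ q.2.1 ∧ q.2.1 ≤ -90 := by decide
  have left : ∀ q ∈ (polygonPieces lowerVertices 7).hull, -192 ≤ q.1 ∧ q.1 ≤ -168 := by decide
  have last : ∀ k : Fin 11, 9 ≤ k → ∀ q ∈ (polygonPieces lowerVertices k).hull,
      (-126 ≤ q.1 ∧ q.1 ≤ -108) ∧ -12 ≤ q.2.1 ∧ q.2.1 ≤ 0 := by decide
  rcases lt_or_ge k 5 with h5 | h5
  · have hx := hP.coord_zero (fun q hq => (right k h5 q hq).1) fun q hq => (right k h5 q hq).2
    norm_num at hx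
    exact untwist_of_turn (by linarith [hx.1])
  rcases lt_or_ge k 7 with h7 | h7
  · have hy := hP.coord_one (fun q hq => (bottom k h5 h7 q hq).1)
      fun q hq => (bottom k h5 h7 q hq).2
    norm_num at hy
    refine untwist_of_far ?_
    rw [axisDistSq, lowerArc_two]
    nlinarith [hy.1, hy.2]
  rcases le_or_gt 9 k with h9 | h9
  · have hx := hP.coord_zero (fun q hq => (last k h9 q hq).1.1) fun q hq => (last k h9 q hq).1.2
    have hy := hP.coord_one (fun q hq => (last k h9 q hq).2.1) fun q hq => (last k h9 q hq).2.2
    norm_num at hx hy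
    refine untwist_of_left (by linarith [hx.1]) (by linarith [hx.2]) ?_
    rw [axisDistSq, lowerArc_two]
    nlinarith [hy.1, hy.2]
  obtain rfl | rfl : k = 7 ∨ k = 8 := by omega
  · have hx := hP.coord_zero (fun q hq => (left q hq).1) fun q hq => (left q hq).2
    norm_num at hx
    exact untwist_of_le (by linarith [hx.2])
  · have hk : |2 * s - (8 : ℕ)| ≤ 1 / 2 := hk
    have hc := polyPath_corner (fun k => scaled 12 (lowerVertices k)) (show 7 < 9 by norm_num)
      (s := 2 * s) (hk.trans (by norm_num))
    change lowerArc s = _ at hc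
    have hα := ramp_nonneg (-(2 * s - (7 + 1 : ℕ)))
    have hβ := ramp_nonneg (2 * s - (7 + 1 : ℕ))
    have hsum := ramp_add_ramp_neg_le hk (by norm_num)
    have hx := congrArg (fun p : R3 => p 0) hc
    have hy := congrArg (fun p : R3 => p 1) hc
    simp [scaled, lowerVertices, vertices] at hx hy
    -- Up to the rounding of the corner at x = -6 the arc is still on the axis. Once the rounding
    -- starts, the edge of length 2 has weight at most 1/4, so x ≥ -13/2 and the rotation is a full
    -- turn.
    rcases le_or_gt (2 * s - (8 : ℕ)) (-(1 / 4)) with hle | hgt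
    · refine untwist_of_axis ?_ (lowerArc_two s)
      rw [hy]
      have := ramp_of_le hle
      norm_num at this ⊢
      rw [this]
    · have h1 := monotone_ramp (show -(2 * s - (8 : ℕ)) ≤ 1 / 4 by linarith)
      rw [ramp_of_ge (s := 1 / 4) (by norm_num)] at h1
      norm_num at hx hy h1 hα hβ hsum
      refine untwist_of_left (by rw [hx]; linarith) (by rw [hx]; linarith) ?_
      rw [axisDistSq, lowerArc_two, hy]
      nlinarith

/-! ### The symmetry of the standard position -/

theorem polyPath_reverse (v : ℕ → R3) (s : ℝ) :
    polyPath v 9 (10 - s) = polyPath (fun k => v (10 - k)) 9 s := by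
  have h : ∀ k : ℝ, ramp (10 - s - k) = ramp (s - (10 - k)) - (s - (10 - k)) := fun k => by
    rw [← ramp_neg]; congr 1; ring
  simp only [polyPath, h]
  norm_num
  module

/-- Only the vertices up to n + 1 matter, so the truncated subtraction in 10 - k and the default
vertices of a list are harmless. -/
theorem polyPath_congr {u v : ℕ → R3} {n : ℕ} (h : ∀ k ≤ n + 1, u k = v k) (s : ℝ) :
    polyPath u n s = polyPath v n s := by
  induction n with
  | zero => simp [polyPath, h 0, h 1]
  | succ n ih =>
    rw [polyPath, polyPath, ih fun k hk => h k (by omega), h n (by omega), h (n + 1) (by omega),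
      h (n + 2) (by omega)]

theorem flipMap_polyPath (v : ℕ → R3) (n : ℕ) (s : ℝ) :
    flipMap (polyPath v n s) = polyPath (fun k => flipMap (v k)) n s := by
  induction n with
  | zero => ext m; fin_cases m <;> simp [polyPath, flipMap] <;> ring
  | succ n ih =>
    rw [polyPath, polyPath, ← ih]
    ext m; fin_cases m <;> simp [flipMap] <;> ring

theorem flipMap_scaled (n : ℝ) (p : IntVec) : flipMap (scaled n p) = scaled n (flipVec p) := by
  ext m; fin_cases m <;> simp [flipMap, scaled, flipVec] <;> ring

theorem flipMap_polyPath_reverse {w : ℕ → IntVec} (hw : ∀ k ≤ 10, flipVec (w (10 - k)) = w k)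
    (s : ℝ) : flipMap (polyPath (fun k => scaled 12 (w k)) 9 (2 * (5 - s))) =
      polyPath (fun k => scaled 12 (w k)) 9 (2 * s) := by
  rw [show 2 * (5 - s) = 10 - 2 * s by ring, polyPath_reverse, flipMap_polyPath]
  exact polyPath_congr (fun k hk => by rw [flipMap_scaled, hw k hk]) _

/-- Indices are modulo 4: the flip interchanges the arcs 0 and 2 and reverses each of the arcs 1 and
3, whose vertex lists are symmetric. -/
theorem flipMap_standardArc (i : Fin 4) (s : ℝ) :
    flipMap (standardArc (2 - i) (5 - s)) = standardArc i s := by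
  fin_cases i
  · change flipMap (flipMap (twistedArc (5 - (5 - s)))) = twistedArc s
    rw [flipMap_flipMap, sub_sub_cancel]
  · exact flipMap_polyPath_reverse (by decide) s
  · rfl
  · exact flipMap_polyPath_reverse (by decide) s

theorem untwist_standardArc (i : Fin 4) {s : ℝ} (hs : s ∈ Set.Icc (0 : ℝ) 5) :
    untwist 1 (standardArc i s) = mirrorMap (standardArc i s) := by
  fin_cases i
  · exact untwist_twistedArc hs
  · refine (untwist_middleArc hs).trans ?_
    ext m
    fin_cases m <;> simp [standardArc, mirrorMap, middleArc_two]
  · exact untwist_flip_twistedArc ⟨by linarith [hs.2], by linarith [hs.1]⟩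
  · refine (untwist_lowerArc hs).trans ?_
    ext m
    fin_cases m <;> simp [standardArc, mirrorMap, lowerArc_two]

theorem flipMap_mirrorMap_comm (p : R3) : flipMap (mirrorMap p) = mirrorMap (flipMap p) := by
  ext m; fin_cases m <;> simp [flipMap, mirrorMap]

/-- This is where f(J̄) in the right cylinder is used: x ↦ -x carries it to J. It requires both
cylinders at height 0. -/
theorem flipMap_mirrorMap_linkPiece (J : StringLink) (i : Fin 4) (τ : ℝ) :
    flipMap (mirrorMap (linkPiece J 0 i.rev (1 - τ))) = linkPiece J 0 i τ := by
  ext m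
  fin_cases i <;> fin_cases m <;> simp [Fin.rev, linkPiece, flipMap, mirrorMap, add_comm]

/-- In units of 1/24, strand i at time 6i + τ corresponds to strand 3 - i at time 6(3 - i) + 1 - τ,
and these times add up to 19. On the arcs, untwisting is the mirror map, and the flip permutes them.
-/
theorem untwist_standardKnot (J : StringLink) (s : ℝ) :
    untwist 1 (standardKnot J s) = flipMap (mirrorMap (standardKnot J (19 / 24 - s))) := by
  have hd := decomposes_standardKnot J
  have hd' := hd
  rw [Int.cast_zero] at hd'
  obtain ⟨n, i, ⟨hm, he⟩ | ⟨hm, he⟩⟩ := hd'.exists_local s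
  · rw [he.eq_of_nhds, untwist_linkPiece J i hm, ← flipMap_mirrorMap_linkPiece,
      ← hd'.on_piece i.rev _ ⟨by linarith [hm.2], by linarith [hm.1]⟩, hd.eq_sub_int (19 / 24 - s) (-n)]
    congr 3
    fin_cases i <;> simp [Fin.rev] <;> ring
  · have hm' : 24 * (s - n) - 6 * ((i : ℕ) : ℝ) - 1 ∈ Set.Icc (0 : ℝ) 5 := ⟨hm.1.le, hm.2.le⟩
    rw [he.eq_of_nhds, untwist_standardArc i hm', ← flipMap_standardArc, ← flipMap_mirrorMap_comm,
      ← hd.on_arc (2 - i) _ ⟨by linarith [hm.2], by linarith [hm.1]⟩]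
    by_cases h3 : i = 3
    · subst h3
      -- The last arc occupies times 19 to 24; its reflected times lie between -5 and 0 and need one
      -- more period.
      rw [hd.eq_sub_int (19 / 24 - s) (-n - 1)]
      congr 3
      norm_num
      rw [show ((2 - 3 : Fin 4) : ℕ) = 3 from rfl]
      push_cast
      ring
    · rw [hd.eq_sub_int (19 / 24 - s) (-n)]
      congr 3
      fin_cases i
      · norm_num; ring
      · norm_num
        rw [show ((2 - 1 : Fin 4) : ℕ) = 1 from rfl]
        push_cast
        ring
      · norm_num; ring
      · exact absurd rfl h3

/-! ### The flip as an isotopy, and conclusion. -/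

/-- The rotation by the angle `π t` about the `y`-axis. -/
def verticalRotate (t : ℝ) (p : R3) : R3 :=
  !₂[p 0 * Real.cos (Real.pi * t) + p 2 * Real.sin (Real.pi * t), p 1,
    p 2 * Real.cos (Real.pi * t) - p 0 * Real.sin (Real.pi * t)]

theorem contDiff_verticalRotate : ContDiff ℝ ∞ fun q : ℝ × R3 => verticalRotate q.1 q.2 := by
  have c : ∀ i, ContDiff ℝ ∞ fun q : ℝ × R3 => q.2 i := fun i => (contDiff_coord i).comp contDiff_snd
  have hθ : ContDiff ℝ ∞ fun q : ℝ × R3 => Real.pi * q.1 := contDiff_const.mul contDiff_fst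
  have hc := Real.contDiff_cos.comp hθ
  have hs := Real.contDiff_sin.comp hθ
  exact contDiff_toR3 (((c 0).mul hc).add ((c 2).mul hs)) (c 1) (((c 2).mul hc).sub ((c 0).mul hs))

theorem verticalRotate_neg (t : ℝ) (p : R3) : verticalRotate (-t) (verticalRotate t p) = p := by
  have h := Real.sin_sq_add_cos_sq (Real.pi * t)
  ext m
  fin_cases m <;> simp [verticalRotate]
  · linear_combination (p 0) * h
  · linear_combination (p 2) * h

theorem IsKnot.isotopic_flip {γ : ℝ → R3} (h : IsKnot γ) : Isotopic γ (fun s => flipMap (γ s)) := by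
  have e : (fun s => flipMap (γ s)) = fun s => verticalRotate 1 (γ s) := by
    funext s
    ext m
    fin_cases m <;> simp [verticalRotate, flipMap]
  rw [e]
  refine Isotopic.of_ambient h verticalRotate (fun t => verticalRotate (-t))
    contDiff_verticalRotate (fun t => ?_) verticalRotate_neg fun p => ?_
  · exact (contDiff_verticalRotate.comp (contDiff_const.prodMk contDiff_id)).differentiable (by simp)
  · ext m
    fin_cases m <;> simp [verticalRotate]

theorem isotopic_reverse_mirror_standardKnot (J : StringLink) :
    Isotopic (standardKnot J) (reverseKnot (mirrorImage (standardKnot J))) := by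
  have hS := isKnot_standardKnot J
  have hR := hS.mirror.reverse
  have h1 : Isotopic (standardKnot J) (fun s => untwist 1 (standardKnot J s)) :=
    Isotopic.of_ambient hS untwist (fun t => untwist (-t)) contDiff_untwist
      (fun t => (contDiff_untwist.comp (contDiff_const.prodMk contDiff_id)).differentiable (by simp))
      untwist_neg fun p => by rw [untwist, zero_mul, axisRotate_zero]
  -- The reverse of the mirror image is moved to the form produced by untwisting: a change of
  -- starting point by 19/24, then a half turn about the y-axis.
  have h2 := (Isotopic.of_shift hR (-(19 / 24))).trans (hR.shift (-(19 / 24))).isotopic_flip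
  have e : (fun s => untwist 1 (standardKnot J s)) = fun s =>
      flipMap (reverseKnot (mirrorImage (standardKnot J)) (s + -(19 / 24))) := by
    funext s
    rw [untwist_standardKnot, reverseKnot, mirrorImage]
    congr 3
    ring
  rw [e] at h1
  exact h1.trans h2.symm

end

theorem mainTheorem7 (J : StringLink) : NegativeAmphichiral (figureKnot J) :=
  ⟨isKnot_figureKnot J, ((isotopic_standardKnot J).trans
    (isotopic_reverse_mirror_standardKnot J)).trans (isotopic_standardKnot J).symm.reverse_mirror⟩
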